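/- Let $n\ge 1$, $0<\lambda\le\Lambda$, $\sigma\in(0,2)$ and $\alpha\in(0,1)$. Put $c=-\frac{\alpha}{1-\alpha}$, $B(\alpha)=1-\alpha+\frac{\alpha}{\Gamma(\alpha)}$, $c_\alpha=-c\,\frac{B(\alpha)}{1-\alpha}$, and $E_{\alpha,\alpha}(z)=\sum_{k\ge0}\frac{z^k}{\Gamma(\alpha k+\alpha)}$. For functions $u(x,t)$ of $x\in\mathbb R^n$ and $t\le 0$ let $$\mathcal L u(x,t)=c_\alpha\int_{-\infty}^t\big[u(x,t)-u(x,s)\big](t-s)^{\alpha-1}E_{\alpha,\alpha}\big(c(t-s)^\alpha\big)\,ds$$ be the fractional time derivative with nonsingular Mittag-Leffler kernel, and let $$\mathcal M^+u(x,t)=\int_{\mathbb R^n}\big(\Lambda(\delta_hu(x,t))_+-\lambda(\delta_hu(x,t))_-\big)\frac{dh}{|h|^{n+\sigma}},\qquad \delta_hu(x,t)=u(x+h,t)+u(x-h,t)-2u(x,t).$$ Say that $\mathcal Lu-\mathcal M^+u\le\varepsilon_0$ in the viscosity sense in a set $D$ if, whenever $(x_0,t_0)\in D$, $\varepsilon>0$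 and $\varphi$ is a $C^\infty$ function with $\varphi(x_0,t_0)=u(x_0,t_0)$ and $\varphi\ge u$ on the cylinder $\mathcal C=B_\varepsilon(x_0)\times[t_0-\varepsilon,t_0]$, the function $v$ equal to $\varphi$ on $\mathcal C$ and to $u$ elsewhere satisfies $\mathcal Lv(x_0,t_0)-\mathcal M^+v(x_0,t_0)\le\varepsilon_0$. Point estimate. For all $n,\lambda,\Lambda,\sigma$ as above, all $\mu>0$ and all $\alpha_0\in(0,1)$ there are $\varepsilon_0>0$ and $\theta>0$, depending only on $n,\lambda,\Lambda,\sigma,\mu,\alpha_0$, such that the following holds for every $\alpha\in[\alpha_0,1)$ (so the constants stay uniform as $\alpha\to1$). Let $u$ be bounded and upper semicontinuous on $\mathbb R^n\times(-\infty,0]$, with $u\le1$ on $(\mathbb R^n\times[-2,0])\cup(B_2\times(-\infty,0])$; let $\mathcal Lu-\mathcal M^+u\le\varepsilon_0$ in the viscosity sense in $B_2\times[-2,0]$, and let $|\{u\le0\}\cap(B_1\times[-2,-1])|\ge\mu$. Then $u\le1-\theta$ in $B_1\times[-1,0]$. -/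

import Mathlib

open Set MeasureTheory

/-- The two-parameter Mittag-Leffler function
`E_{α,β}(z) = ∑_{k ≥ 0} z ^ k / Γ(α k + β)` (for `α, β > 0` the series converges for every `z`). -/
noncomputable def mittagLeffler (α β z : ℝ) : ℝ :=
  ∑' k : ℕ, z ^ k / Real.Gamma (α * k + β)

/-- The constant `c = -α / (1 - α)`. -/
noncomputable def abRate (α : ℝ) : ℝ := -(α / (1 - α))

/-- The normalisation `B(α) = 1 - α + α / Γ(α)`. -/
noncomputable def abNorm (α : ℝ) : ℝ := 1 - α + α / Real.Gamma α

/-- The constant `c_α = -c B(α) / (1 - α)`. -/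
noncomputable def abConst (α : ℝ) : ℝ := -abRate α * (abNorm α / (1 - α))

/-- The time kernel `𝒯(t,s) = (t - s) ^ (α - 1) E_{α,α}(c (t - s) ^ α)`, `s < t`,
as a function of the elapsed time `r = t - s`. -/
noncomputable def abKernel (α r : ℝ) : ℝ :=
  r ^ (α - 1) * mittagLeffler α α (abRate α * r ^ α)

/-- The fractional time derivative with nonsingular Mittag-Leffler kernel,
`ℒ u (x,t) = c_α ∫_{-∞}^t (u(x,t) - u(x,s)) 𝒯(t,s) ds`. -/
noncomputable def timeDeriv {n : ℕ} (α : ℝ) (u : EuclideanSpace ℝ (Fin n) × ℝ → ℝ)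
    (p : EuclideanSpace ℝ (Fin n) × ℝ) : ℝ :=
  abConst α * ∫ s in Iio p.2, (u p - u (p.1, s)) * abKernel α (p.2 - s)

/-- The second order difference `δ_h u (x,t) = u(x+h,t) + u(x-h,t) - 2 u(x,t)` in space. -/
noncomputable def secondDiff {n : ℕ} (u : EuclideanSpace ℝ (Fin n) × ℝ → ℝ)
    (h : EuclideanSpace ℝ (Fin n)) (p : EuclideanSpace ℝ (Fin n) × ℝ) : ℝ :=
  u (p.1 + h, p.2) + u (p.1 - h, p.2) - 2 * u p

/-- The maximal extremal operator of order `σ` with ellipticity constants `lam ≤ Lam`,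
`ℳ⁺u(x,t) = ∫ (Lam (δ_h u)₊ - lam (δ_h u)₋) |h|^{-n-σ} dh`. -/
noncomputable def extremalPlus {n : ℕ} (lam Lam σ : ℝ) (u : EuclideanSpace ℝ (Fin n) × ℝ → ℝ)
    (p : EuclideanSpace ℝ (Fin n) × ℝ) : ℝ :=
  ∫ h : EuclideanSpace ℝ (Fin n),
    (Lam * max (secondDiff u h p) 0 - lam * max (-secondDiff u h p) 0) * ‖h‖ ^ (-(n : ℝ) - σ)

/-- The backward cylinder `B_ε(x₀) × [t₀ - ε, t₀]`. -/
def backCylinder {n : ℕ} (ε : ℝ) (p : EuclideanSpace ℝ (Fin n) × ℝ) :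
    Set (EuclideanSpace ℝ (Fin n) × ℝ) :=
  Metric.ball p.1 ε ×ˢ Icc (p.2 - ε) p.2

open Classical in
/-- The function equal to `φ` on `C` and to `u` elsewhere. -/
noncomputable def replaceOn {X : Type*} (C : Set X) (φ u : X → ℝ) : X → ℝ :=
  fun p => if p ∈ C then φ p else u p

/-- `ℒ u - ℳ⁺u ≤ g` in the viscosity sense on `D`: whenever a smooth `φ` touches `u` from above at
`p ∈ D` on a backward cylinder, the function equal to `φ` on the cylinder and to `u` elsewhere
satisfies the inequality at `p`. -/
def IsViscositySubsolution {n : ℕ} (α lam Lam σ g : ℝ) (D : Set (EuclideanSpace ℝ (Fin n) × ℝ))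
    (u : EuclideanSpace ℝ (Fin n) × ℝ → ℝ) : Prop :=
  ∀ p ∈ D, ∀ ε > 0, ∀ φ : EuclideanSpace ℝ (Fin n) × ℝ → ℝ,
    ContDiff ℝ ((⊤ : ℕ∞) : WithTop ℕ∞) φ → φ p = u p → (∀ q ∈ backCylinder ε p, u q ≤ φ q) →
      timeDeriv α (replaceOn (backCylinder ε p) φ u) p -
        extremalPlus lam Lam σ (replaceOn (backCylinder ε p) φ u) p ≤ g

/-! The proof is by contradiction, with a barrier that separates the variables. In space, take a
smooth cutoff η of the unit ball with ℳ⁺(-η) ≤ C η on the closed ball of radius 3/2. In time, take a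
solution m ≥ 0 of ℒm + C₁m = c f, where the smooth pulse f(t) lies below the measure of {u(·,t) <
1/4} in B₁. Memory keeps m ≥ 2θ on [-1,0]. If u > 1 - θ somewhere in B₁ × [-1,0], then u + mη - θeᵗ
has a maximum W > 1 over the closed 3/2-ball times [-2,0], so φ = W - mη + θeᵗ touches u from above
at some (x₀,t₀). It stays above u on all of space at time t₀ and on the whole past at x₀, which is
what the two nonlocal operators see.

Where u < 1/4 there is a gap of at least 1/2 below φ, and this lowers ℳ⁺ by c f(t₀), up to a small
ball around x₀ (`spaceOp_le_of_touching`). Replacing the past of φ by u only raises ℒ, because the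
kernel is positive (`timeOp_le_of_touching`). The equation of m absorbs every term except ℒ(θeᵗ) =
B(α)θeᵗ ≥ 2ε₀, which contradicts the viscosity inequality.

Uniformity as α → 1 comes from solving for m explicitly (`exists_time_barrier`). The solution is f
plus a convolution of f with a relaxation kernel r^(α-1) E_{α,α}(-q r^α), with coefficients and rate
q that stay controlled although the constants of ℒ blow up. What is needed of the kernel is
positivity, mass 1/q and a uniform lower bound on (0,2]. All three follow from the resolvent
identity `integral_mlKernel_mul`: positivity and the lower bound through a Volterra equation
(`mlDecay_lower`), the mass through the Laplace transform. -/

/-! ### Riemann-Liouville kernels and convergence of the Mittag-Leffler series. -/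

/-- The Riemann-Liouville kernel `r ^ (x - 1) / Γ(x)` of order `x`. -/
noncomputable def rlKernel (x r : ℝ) : ℝ := r ^ (x - 1) / Real.Gamma x

theorem rlKernel_nonneg {x r : ℝ} (hx : 0 < x) (hr : 0 ≤ r) : 0 ≤ rlKernel x r :=
  div_nonneg (Real.rpow_nonneg hr _) (Real.Gamma_pos_of_pos hx).le

theorem intervalIntegrable_rlKernel {x : ℝ} (hx : 0 < x) (a b : ℝ) :
    IntervalIntegrable (rlKernel x) volume a b :=
  (intervalIntegral.intervalIntegrable_rpow' (by linarith)).div_const _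

theorem intervalIntegrable_rlKernel_mul {x y r : ℝ} (hx : 0 < x) (hy : 0 < y) (hr : 0 < r) :
    IntervalIntegrable (fun s => rlKernel x s * rlKernel y (r - s)) volume 0 r := by
  have left : ∀ {x y : ℝ}, 0 < x → 0 < y →
      IntervalIntegrable (fun s => rlKernel x s * rlKernel y (r - s)) volume 0 (r / 2) := by
    intro x y hx hy
    refine (intervalIntegrable_rlKernel hx 0 (r / 2)).mul_continuousOn ?_
    unfold rlKernel
    refine ContinuousOn.div_const (ContinuousOn.rpow_const (by fun_prop) ?_) _
    intro s hs
    rw [uIcc_of_le (by linarith)] at hs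
    left
    linarith [hs.2]
  refine (left hx hy).trans ?_
  have h := ((left hy hx).comp_sub_left r)
  have e : (fun s => rlKernel y (r - s) * rlKernel x (r - (r - s))) =
      fun s => rlKernel x s * rlKernel y (r - s) := by
    funext s
    rw [sub_sub_cancel, mul_comm]
  rw [e] at h
  have e2 : r - r / 2 = r / 2 := by ring
  rw [sub_zero, e2] at h
  exact h.symm

/-- The semigroup property of the Riemann-Liouville kernels. -/
theorem integral_rlKernel_mul {x y r : ℝ} (hx : 0 < x) (hy : 0 < y) (hr : 0 < r) :
    ∫ s in (0)..r, rlKernel x s * rlKernel y (r - s) = rlKernel (x + y) r := by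
  have h1 := Complex.betaIntegral_scaled x y hr
  have h2 : (Complex.betaIntegral x y) = ((ProbabilityTheory.beta x y : ℝ) : ℂ) := by
    rw [Complex.betaIntegral_eq_Gamma_mul_div _ _ (by simpa) (by simpa), ProbabilityTheory.beta]
    push_cast [← Complex.Gamma_ofReal]
    rfl
  have h3 : ∫ s in (0)..r, s ^ (x - 1) * (r - s) ^ (y - 1) =
      r ^ (x + y - 1) * ProbabilityTheory.beta x y := by
    apply Complex.ofReal_injective
    rw [← intervalIntegral.integral_ofReal]
    rw [Complex.ofReal_mul, ← h2, Complex.ofReal_cpow hr.le]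
    push_cast
    rw [← h1]
    refine intervalIntegral.integral_congr fun s hs => ?_
    rw [uIcc_of_le hr.le] at hs
    rw [Complex.ofReal_cpow hs.1, Complex.ofReal_cpow (sub_nonneg.2 hs.2)]
    push_cast
    rfl
  have hG := Real.Gamma_pos_of_pos hx
  have hG' := Real.Gamma_pos_of_pos hy
  have e : (fun s => rlKernel x s * rlKernel y (r - s)) =
      fun s => (s ^ (x - 1) * (r - s) ^ (y - 1)) * (1 / (Real.Gamma x * Real.Gamma y)) := by
    funext s
    unfold rlKernel
    field_simp
  rw [e, intervalIntegral.integral_mul_const, h3, ProbabilityTheory.beta, rlKernel]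
  field_simp

/-- The part of the Gamma integral over (A, A + 1] already suffices. -/
theorem rpow_le_mul_Gamma {A x : ℝ} (hA : 1 ≤ A) (hx : 1 ≤ x) :
    A ^ x ≤ A * Real.exp (A + 1) * Real.Gamma x := by
  have hx0 : 0 < x := by linarith
  have h1 : A ^ (x - 1) * Real.exp (-(A + 1)) ≤ Real.Gamma x := by
    rw [Real.Gamma_eq_integral hx0]
    have hint := Real.GammaIntegral_convergent hx0
    have hsub : Ioc A (A + 1) ⊆ Ioi (0 : ℝ) := fun s hs => by
      have := hs.1
      simp only [mem_Ioi]
      linarith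
    calc A ^ (x - 1) * Real.exp (-(A + 1))
        = ∫ s in Ioc A (A + 1), A ^ (x - 1) * Real.exp (-(A + 1)) := by simp
      _ ≤ ∫ s in Ioc A (A + 1), Real.exp (-s) * s ^ (x - 1) := by
          refine setIntegral_mono_on (integrableOn_const (by simp)) (hint.mono_set hsub) measurableSet_Ioc ?_
          intro s hs
          rw [mul_comm]
          have h1 := hs.1.le
          have h2 := hs.2
          gcongr
      _ ≤ ∫ s in Ioi 0, Real.exp (-s) * s ^ (x - 1) := by
          refine setIntegral_mono_set hint ?_ hsub.eventuallyLE
          filter_upwards [ae_restrict_mem measurableSet_Ioi] with s hs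
          exact mul_nonneg (Real.exp_pos _).le (Real.rpow_nonneg (le_of_lt hs) _)
  have hA0 : 0 < A := by linarith
  calc A ^ x = A * Real.exp (A + 1) * (A ^ (x - 1) * Real.exp (-(A + 1))) := by
        rw [Real.exp_neg, Real.rpow_sub_one hA0.ne']
        field_simp
    _ ≤ _ := by gcongr

/-- Extends the previous bound to small x: apply it at x + 1 with A = eD, so that the extra e^x
absorbs the factor x in Γ(x + 1) = xΓ(x). -/
theorem rpow_le_exp_mul_Gamma {D x : ℝ} (hD : 1 ≤ D) (hx : 0 < x) :
    D ^ x ≤ Real.exp (Real.exp 1 * D + 1) * Real.Gamma x := by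
  have he : 1 ≤ Real.exp 1 := Real.one_le_exp zero_le_one
  have hA : 1 ≤ Real.exp 1 * D := one_le_mul_of_one_le_of_one_le he hD
  have h := rpow_le_mul_Gamma hA (by linarith : 1 ≤ x + 1)
  rw [Real.Gamma_add_one hx.ne', Real.rpow_add_one (by positivity),
    Real.mul_rpow (by positivity) (by positivity), ← Real.exp_mul, one_mul] at h
  have hxe : x ≤ Real.exp x := by linarith [Real.add_one_le_exp x]
  have hG := Real.Gamma_pos_of_pos hx
  have h2 : Real.exp x * D ^ x ≤ Real.exp (Real.exp 1 * D + 1) * Real.Gamma x * x := by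
    refine le_of_mul_le_mul_right ?_ (by positivity : 0 < Real.exp 1 * D)
    linarith
  have h3 : x * D ^ x ≤ Real.exp x * D ^ x := by gcongr
  refine le_of_mul_le_mul_left ?_ hx
  linarith

theorem exists_abs_pow_div_Gamma_le {α : ℝ} (hα : 0 < α) (z : ℝ) :
    ∃ C > 0, ∀ k : ℕ, |z| ^ k / Real.Gamma (α * k + α) ≤ C * (1 / 2) ^ k := by
  -- With D = w^(1/α) the power D^(αk+α) is w^(k+1); the factor 2 in w yields the geometric decay.
  set w : ℝ := 2 * (|z| + 1) with hw
  have hw1 : 1 ≤ w := by have := abs_nonneg z; linarith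
  have hD : 1 ≤ w ^ (1 / α) := Real.one_le_rpow hw1 (by positivity)
  refine ⟨Real.exp (Real.exp 1 * w ^ (1 / α) + 1), Real.exp_pos _, fun k => ?_⟩
  have hx : 0 < α * k + α := by positivity
  have hG := Real.Gamma_pos_of_pos hx
  have h := rpow_le_exp_mul_Gamma hD hx
  have e : (w ^ (1 / α)) ^ (α * k + α) = w ^ (k + 1) := by
    rw [← Real.rpow_mul (by linarith), ← Real.rpow_natCast]
    congr 1
    push_cast
    field_simp
  rw [e] at h
  rw [div_le_iff₀ hG]
  have h4 : |z| ^ k * 2 ^ k ≤ w ^ (k + 1) := by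
    rw [← mul_pow]
    calc (|z| * 2) ^ k ≤ w ^ k := by gcongr; linarith
      _ ≤ w ^ (k + 1) := pow_le_pow_right₀ hw1 (Nat.le_succ k)
  calc |z| ^ k = (|z| ^ k * 2 ^ k) * (1 / 2) ^ k := by
        rw [mul_assoc, ← mul_pow]; norm_num
    _ ≤ (Real.exp (Real.exp 1 * w ^ (1 / α) + 1) * Real.Gamma (α * k + α)) * (1 / 2) ^ k := by
        refine mul_le_mul_of_nonneg_right (h4.trans h) (by positivity)
    _ = _ := by ring

theorem summable_pow_div_Gamma {α : ℝ} (hα : 0 < α) (z : ℝ) :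
    Summable fun k : ℕ => z ^ k / Real.Gamma (α * k + α) := by
  obtain ⟨C, -, h⟩ := exists_abs_pow_div_Gamma_le hα z
  refine Summable.of_norm_bounded (g := fun k => C * (1 / 2) ^ k)
    (summable_geometric_two.mul_left C) fun k => ?_
  have hG := Real.Gamma_pos_of_pos (by positivity : 0 < α * k + α)
  rw [norm_div, norm_pow, Real.norm_eq_abs, Real.norm_of_nonneg hG.le]
  exact h k

theorem continuous_mittagLeffler {α : ℝ} (hα : 0 < α) : Continuous (mittagLeffler α α) := by
  rw [continuous_iff_continuousAt]
  intro z₀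
  have h : ContinuousOn (mittagLeffler α α) (Metric.ball 0 (|z₀| + 1)) := by
    refine continuousOn_tsum (u := fun k : ℕ => (|z₀| + 1) ^ k / Real.Gamma (α * k + α))
      (fun k => by fun_prop) (summable_pow_div_Gamma hα _) fun k z hz => ?_
    have hG := Real.Gamma_pos_of_pos (by positivity : 0 < α * k + α)
    rw [norm_div, norm_pow, Real.norm_of_nonneg hG.le]
    have : ‖z‖ ≤ |z₀| + 1 := by simpa using (Metric.mem_ball.1 hz).le
    gcongr
  exact h.continuousAt (Metric.isOpen_ball.mem_nhds (by simp))

/-! ### The relaxation kernel and its resolvent identity. -/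

/-- The relaxation kernel `r ^ (α - 1) E_{α,α}(-q r ^ α)`, the kernel with Laplace transform
`1 / (s ^ α + q)`. -/
noncomputable def mlKernel (α q r : ℝ) : ℝ := r ^ (α - 1) * mittagLeffler α α (-q * r ^ α)

theorem abKernel_eq_mlKernel (α r : ℝ) : abKernel α r = mlKernel α (α / (1 - α)) r := rfl

theorem mittagLeffler_zero {α : ℝ} : mittagLeffler α α 0 = 1 / Real.Gamma α := by
  rw [mittagLeffler, tsum_eq_single 0]
  · simp
  · intro k hk
    simp [hk]

theorem mlKernel_zero (α r : ℝ) : mlKernel α 0 r = rlKernel α r := by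
  rw [mlKernel, neg_zero, zero_mul, mittagLeffler_zero, rlKernel, mul_one_div]

theorem rlKernel_succ_mul {α r : ℝ} (hr : 0 < r) (k : ℕ) :
    rlKernel (α * (k + 1)) r = r ^ (α - 1) * ((r ^ α) ^ k / Real.Gamma (α * k + α)) := by
  rw [rlKernel, ← Real.rpow_natCast, ← Real.rpow_mul hr.le, ← mul_div_assoc, ← Real.rpow_add hr]
  congr 2 <;> ring

theorem hasSum_mlKernel {α r : ℝ} (hα : 0 < α) (q : ℝ) (hr : 0 < r) :
    HasSum (fun k : ℕ => (-q) ^ k * rlKernel (α * (k + 1)) r) (mlKernel α q r) := by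
  have h := (summable_pow_div_Gamma hα (-q * r ^ α)).hasSum.mul_left (r ^ (α - 1))
  convert! h using 1
  funext k
  rw [rlKernel_succ_mul hr, mul_pow]
  ring

theorem continuousOn_mlKernel {α : ℝ} (hα : 0 < α) (q : ℝ) :
    ContinuousOn (mlKernel α q) (Ioi 0) := by
  unfold mlKernel
  have h1 : ∀ p : ℝ, ContinuousOn (fun r : ℝ => r ^ p) (Ioi 0) := fun p r hr =>
    (Real.continuousAt_rpow_const _ _ (Or.inl (ne_of_gt hr))).continuousWithinAt
  exact (h1 _).mul ((continuous_mittagLeffler hα).comp_continuousOn ((h1 α).const_mul (-q)))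

theorem summable_integral_pair {α r : ℝ} (hα : 0 < α) (hr : 0 < r) (p q : ℝ) :
    Summable fun i : ℕ × ℕ => |p| ^ i.1 * |q| ^ i.2 *
      rlKernel (α * (i.1 + 1) + α * (i.2 + 1)) r := by
  set Z : ℝ := max 1 (max |p| |q|) with hZ
  have hZ1 : 1 ≤ Z := le_max_left _ _
  have hZp : |p| ≤ Z := (le_max_left _ _).trans (le_max_right _ _)
  have hZq : |q| ≤ Z := (le_max_right _ _).trans (le_max_right _ _)
  obtain ⟨C, hC, h⟩ := exists_abs_pow_div_Gamma_le hα (Z * r ^ α)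
  have hs : Summable fun i : ℕ × ℕ => (1 / 2 : ℝ) ^ i.1 * (1 / 2) ^ i.2 :=
    summable_geometric_two.mul_of_nonneg summable_geometric_two
      (fun _ => by positivity) (fun _ => by positivity)
  refine Summable.of_nonneg_of_le (fun i => ?_) (fun i => ?_)
    (hs.mul_left (r ^ (α - 1) * C))
  · have := rlKernel_nonneg (x := α * (i.1 + 1) + α * (i.2 + 1)) (by positivity) hr.le
    positivity
  · have e : α * ((i.1 : ℝ) + 1) + α * (i.2 + 1) = α * (((i.1 + i.2 + 1 : ℕ) : ℝ) + 1) := by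
      push_cast; ring
    rw [e, rlKernel_succ_mul hr]
    have h1 := h (i.1 + i.2 + 1)
    rw [abs_of_pos (by positivity), mul_pow] at h1
    have hG := Real.Gamma_pos_of_pos (by positivity : 0 < α * ((i.1 + i.2 + 1 : ℕ) : ℝ) + α)
    have h2 : |p| ^ i.1 * |q| ^ i.2 ≤ Z ^ (i.1 + i.2 + 1) := by
      calc |p| ^ i.1 * |q| ^ i.2 ≤ Z ^ i.1 * Z ^ i.2 := by gcongr
        _ = Z ^ (i.1 + i.2) := (pow_add _ _ _).symm
        _ ≤ _ := pow_le_pow_right₀ hZ1 (Nat.le_succ _)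
    calc _ = r ^ (α - 1) * ((|p| ^ i.1 * |q| ^ i.2) * (r ^ α) ^ (i.1 + i.2 + 1) /
            Real.Gamma (α * ((i.1 + i.2 + 1 : ℕ) : ℝ) + α)) := by ring
      _ ≤ r ^ (α - 1) * (Z ^ (i.1 + i.2 + 1) * (r ^ α) ^ (i.1 + i.2 + 1) /
            Real.Gamma (α * ((i.1 + i.2 + 1 : ℕ) : ℝ) + α)) := by gcongr
      _ ≤ r ^ (α - 1) * (C * (1 / 2) ^ (i.1 + i.2 + 1)) := by gcongr
      _ ≤ r ^ (α - 1) * (C * (1 / 2) ^ (i.1 + i.2)) := by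
          gcongr r ^ (α - 1) * (C * ?_)
          exact pow_le_pow_of_le_one (by norm_num) (by norm_num) (Nat.le_succ _)
      _ = _ := by rw [pow_add]; ring

/-- Double series expansion of the convolution of two relaxation kernels. -/
theorem hasSum_integral_mlKernel_mul {α r : ℝ} (hα : 0 < α) (hr : 0 < r) (p q : ℝ) :
    IntervalIntegrable (fun s => mlKernel α p s * mlKernel α q (r - s)) volume 0 r ∧
    HasSum (fun i : ℕ × ℕ => (-p) ^ i.1 * (-q) ^ i.2 *
      rlKernel (α * (i.1 + 1) + α * (i.2 + 1)) r)
      (∫ s in (0)..r, mlKernel α p s * mlKernel α q (r - s)) := by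
  set F : ℕ × ℕ → ℝ → ℝ := fun i s => ((-p) ^ i.1 * (-q) ^ i.2) *
    (rlKernel (α * (i.1 + 1)) s * rlKernel (α * (i.2 + 1)) (r - s)) with hF
  have hpos : ∀ i : ℕ, 0 < α * ((i : ℝ) + 1) := fun i => by positivity
  have hint : ∀ i, IntervalIntegrable (F i) volume 0 r := fun i =>
    (intervalIntegrable_rlKernel_mul (hpos _) (hpos _) hr).const_mul _
  have hint' : ∀ i, Integrable (F i) (volume.restrict (Ioo 0 r)) := fun i =>
    (hint i).1.mono_set Ioo_subset_Ioc_self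
  have hval : ∀ i, ∫ s in Ioo 0 r, F i s = (-p) ^ i.1 * (-q) ^ i.2 *
      rlKernel (α * (i.1 + 1) + α * (i.2 + 1)) r := fun i => by
    rw [← integral_Ioc_eq_integral_Ioo, ← intervalIntegral.integral_of_le hr.le]
    simp only [hF]
    rw [intervalIntegral.integral_const_mul, integral_rlKernel_mul (hpos _) (hpos _) hr]
  have hnorm : ∀ i, ∫ s in Ioo 0 r, ‖F i s‖ = |p| ^ i.1 * |q| ^ i.2 *
      rlKernel (α * (i.1 + 1) + α * (i.2 + 1)) r := fun i => by
    rw [← integral_rlKernel_mul (hpos _) (hpos _) hr, intervalIntegral.integral_of_le hr.le,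
      integral_Ioc_eq_integral_Ioo, ← integral_const_mul]
    refine setIntegral_congr_fun measurableSet_Ioo fun s hs => ?_
    simp only [hF]
    rw [norm_mul, norm_mul, norm_pow, norm_pow, norm_neg, norm_neg, Real.norm_eq_abs,
      Real.norm_eq_abs, Real.norm_of_nonneg]
    exact mul_nonneg (rlKernel_nonneg (hpos _) hs.1.le)
      (rlKernel_nonneg (hpos _) (sub_nonneg.2 hs.2.le))
  -- Taking norms only replaces -p, -q by |p|, |q|, so the norm integrals form a convergent series
  -- of the same shape and termwise integration is allowed.
  have hsum : Summable fun i => ∫ s in Ioo 0 r, ‖F i s‖ := by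
    simp_rw [hnorm]
    exact summable_integral_pair hα hr p q
  have hpt : ∀ s ∈ Ioo 0 r, HasSum (fun i => F i s) (mlKernel α p s * mlKernel α q (r - s)) := by
    intro s hs
    have h1 := hasSum_mlKernel hα p hs.1
    have h2 := hasSum_mlKernel hα q (sub_pos.2 hs.2)
    have hn : ∀ (p : ℝ) {s : ℝ}, 0 < s →
        Summable fun k : ℕ => ‖(-p) ^ k * rlKernel (α * (k + 1)) s‖ := fun p s hs => by
      refine ((hasSum_mlKernel hα (-|p|) hs).summable).congr fun k => ?_
      rw [norm_mul, norm_pow, norm_neg, Real.norm_of_nonneg (rlKernel_nonneg (hpos k) hs.le),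
        neg_neg, Real.norm_eq_abs]
    refine (h1.mul h2 (summable_mul_of_summable_norm (hn p hs.1)
      (hn q (sub_pos.2 hs.2)))).congr_fun fun i => ?_
    simp only [hF]
    ring
  have hmain := hasSum_integral_of_summable_integral_norm hint' hsum
  simp_rw [hval] at hmain
  refine ⟨?_, ?_⟩
  · have hc : ∀ p : ℝ, Continuous fun s : ℝ => mittagLeffler α α (-p * s ^ α) := fun p =>
      (continuous_mittagLeffler hα).comp ((Real.continuous_rpow_const hα.le).const_mul _)
    have h := ((intervalIntegrable_rlKernel_mul hα hα hr).mul_continuousOn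
      (((hc p).mul ((hc q).comp (continuous_sub_left r))).continuousOn)).const_mul
        (Real.Gamma α * Real.Gamma α)
    refine h.congr fun s _ => ?_
    have hG := Real.Gamma_pos_of_pos hα
    simp only [rlKernel, mlKernel, Pi.mul_apply, Function.comp_apply]
    field_simp
  · convert! hmain using 1
    rw [intervalIntegral.integral_of_le hr.le, integral_Ioc_eq_integral_Ioo]
    exact setIntegral_congr_fun measurableSet_Ioo fun s hs => (hpt s hs).tsum_eq.symm

theorem intervalIntegrable_mlKernel_mul {α r : ℝ} (hα : 0 < α) (hr : 0 < r) (p q : ℝ) :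
    IntervalIntegrable (fun s => mlKernel α p s * mlKernel α q (r - s)) volume 0 r :=
  (hasSum_integral_mlKernel_mul hα hr p q).1

/-- The resolvent identity: the convolution of two relaxation kernels is their divided
difference. -/
theorem integral_mlKernel_mul {α r : ℝ} (hα : 0 < α) (hr : 0 < r) (p q : ℝ) :
    (p - q) * ∫ s in (0)..r, mlKernel α p s * mlKernel α q (r - s) =
      mlKernel α q r - mlKernel α p r := by
  have h := (hasSum_integral_mlKernel_mul hα hr p q).2
  -- The Riemann-Liouville order depends only on i + j = n. On each antidiagonal the sum of (-p)^i
  -- (-q)^j, times p - q, telescopes to (-q)^(n+1) - (-p)^(n+1).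
  rw [← Finset.HasAntidiagonal.sigmaAntidiagonalEquivProd.hasSum_iff] at h
  have h1 := (h.sigma fun n => hasSum_fintype _).mul_left (p - q)
  have h2 := (hasSum_mlKernel hα q hr).sub (hasSum_mlKernel hα p hr)
  -- The terms of index 0 of the two kernels cancel, hence the shift by one.
  have h3 := (hasSum_nat_add_iff' 1).2 h2
  simp only [Finset.range_one, Finset.sum_singleton, pow_zero, sub_self, sub_zero] at h3
  refine h1.unique (h3.congr_fun fun n => ?_)
  have e : ∀ c : Finset.HasAntidiagonal.antidiagonal n, ((fun i : ℕ × ℕ => (-p) ^ i.1 * (-q) ^ i.2 *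
      rlKernel (α * (i.1 + 1) + α * (i.2 + 1)) r) ∘
        Finset.HasAntidiagonal.sigmaAntidiagonalEquivProd) ⟨n, c⟩ =
      (-p) ^ (c : ℕ × ℕ).1 * (-q) ^ (c : ℕ × ℕ).2 * rlKernel (α * ((n + 1 : ℕ) + 1)) r := by
    rintro ⟨⟨i, j⟩, hc⟩
    have hij : i + j = n := Finset.HasAntidiagonal.mem_antidiagonal.1 hc
    simp only [Function.comp, Finset.HasAntidiagonal.sigmaAntidiagonalEquivProd_apply]
    congr 2
    rw [← hij]
    push_cast
    ring
  simp_rw [e]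
  rw [Finset.sum_coe_sort (Finset.HasAntidiagonal.antidiagonal n) (fun c => (-p) ^ c.1 * (-q) ^ c.2 *
    rlKernel (α * ((n + 1 : ℕ) + 1)) r), ← Finset.sum_mul,
    Finset.Nat.sum_antidiagonal_eq_sum_range_succ (fun i j => (-p) ^ i * (-q) ^ j),
    ← mul_assoc, ← sub_mul]
  congr 1
  have := (Commute.all (-p) (-q)).geom_sum₂_mul (n + 1)
  simp only [Nat.add_sub_cancel] at this
  linarith

/-! ### Positivity of the relaxation kernel and quantitative decay. -/

/-- The regular part `E_{α,α}(-q t ^ α)` of the relaxation kernel. -/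
noncomputable def mlDecay (α q t : ℝ) : ℝ := mittagLeffler α α (-q * t ^ α)

theorem continuous_mlDecay {α : ℝ} (hα : 0 < α) (q : ℝ) : Continuous (mlDecay α q) :=
  (continuous_mittagLeffler hα).comp ((Real.continuous_rpow_const hα.le).const_mul _)

theorem mlKernel_eq (α q r : ℝ) : mlKernel α q r = r ^ (α - 1) * mlDecay α q r := rfl

theorem mlDecay_eq {α q t : ℝ} (ht : 0 < t) : mlDecay α q t = t ^ (1 - α) * mlKernel α q t := by
  rw [mlKernel_eq, ← mul_assoc, ← Real.rpow_add ht]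
  simp

theorem mlDecay_zero {α q : ℝ} (hα : 0 < α) : mlDecay α q 0 = 1 / Real.Gamma α := by
  rw [mlDecay, Real.zero_rpow hα.ne', mul_zero, mittagLeffler_zero]

/-- The resolvent identity against rate 0, multiplied by t^(1-α) to remove the singularity at the
origin. -/
theorem mlDecay_volterra {α q t : ℝ} (hα : 0 < α) (ht : 0 < t) :
    mlDecay α q t = 1 / Real.Gamma α -
      q * ∫ s in (0)..t, mlKernel α q s * (rlKernel α (t - s) * t ^ (1 - α)) := by
  have h := integral_mlKernel_mul hα ht q 0
  simp_rw [mlKernel_zero, sub_zero] at h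
  have e : ∫ s in (0)..t, mlKernel α q s * (rlKernel α (t - s) * t ^ (1 - α)) =
      (∫ s in (0)..t, mlKernel α q s * rlKernel α (t - s)) * t ^ (1 - α) := by
    rw [← intervalIntegral.integral_mul_const]
    simp_rw [mul_assoc]
  have e2 : rlKernel α t * t ^ (1 - α) = 1 / Real.Gamma α := by
    rw [rlKernel, div_mul_eq_mul_div, ← Real.rpow_add ht]
    simp
  rw [e, ← mul_assoc, h, mlDecay_eq ht, ← e2]
  ring

/-- The weight is (t / (t - s))^(1-α) / Γ(α), and t / (t - s) decreases in t. -/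
theorem rlKernel_weight_mono {α s t t₀ : ℝ} (hα : α ∈ Ioo (0 : ℝ) 1) (hs : 0 < s) (hst : s < t)
    (htt : t < t₀) : rlKernel α (t₀ - s) * t₀ ^ (1 - α) ≤ rlKernel α (t - s) * t ^ (1 - α) := by
  have hG := Real.Gamma_pos_of_pos hα.1
  have e : ∀ r : ℝ, s < r → rlKernel α (r - s) * r ^ (1 - α) =
      (r / (r - s)) ^ (1 - α) / Real.Gamma α := fun r hr => by
    have h1 : 0 < r - s := sub_pos.2 hr
    rw [rlKernel, Real.div_rpow (by linarith) h1.le, ← neg_sub 1 α, Real.rpow_neg h1.le]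
    field_simp
  rw [e _ (hst.trans htt), e _ hst]
  refine div_le_div_of_nonneg_right (Real.rpow_le_rpow ?_ ?_ (by linarith [hα.2])) hG.le
  · exact div_nonneg (by linarith) (by linarith)
  · rw [div_le_div_iff₀ (by linarith) (by linarith)]
    nlinarith

/-- The left side is (1/s + 1/(t₀ - s))^(1-α) / Γ(α), and the power 1 - α is subadditive. -/
theorem rpow_mul_weight_le {α s t₀ : ℝ} (hα : α ∈ Ioo (0 : ℝ) 1) (hs : 0 < s) (hst : s < t₀) :
    s ^ (α - 1) * (rlKernel α (t₀ - s) * t₀ ^ (1 - α)) ≤ rlKernel α (t₀ - s) + rlKernel α s := by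
  have hG := Real.Gamma_pos_of_pos hα.1
  have h0 : 0 < t₀ - s := sub_pos.2 hst
  have hp : (0 : ℝ) ≤ 1 - α := by linarith [hα.2]
  have e : ∀ r : ℝ, 0 < r → r ^ (α - 1) = (1 / r) ^ (1 - α) := fun r hr => by
    rw [← neg_sub 1 α, Real.rpow_neg hr.le, one_div, Real.inv_rpow hr.le]
  rw [rlKernel, rlKernel, e s hs, e _ h0, ← add_div]
  have h1 : (1 / s) ^ (1 - α) * ((1 / (t₀ - s)) ^ (1 - α) * t₀ ^ (1 - α)) =
      (1 / (t₀ - s) + 1 / s) ^ (1 - α) := by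
    rw [← Real.mul_rpow (by positivity) (by linarith), ← Real.mul_rpow (by positivity)
      (mul_nonneg (by positivity) (by linarith))]
    congr 1
    field_simp
    ring
  rw [div_mul_eq_mul_div, ← mul_div_assoc, h1]
  gcongr
  exact Real.rpow_add_le_add_rpow (by positivity) (by positivity) hp (by linarith [hα.1])

theorem integral_rlKernel {α a b : ℝ} (hα : 0 < α) :
    ∫ s in a..b, rlKernel α s = (b ^ α - a ^ α) / Real.Gamma (α + 1) := by
  have hG := Real.Gamma_pos_of_pos hα
  simp_rw [rlKernel]
  rw [intervalIntegral.integral_div, integral_rpow (Or.inl (by linarith)), Real.Gamma_add_one hα.ne']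
  simp only [sub_add_cancel]
  field_simp

/-- Compare the Volterra equations at t and t₀: on [0, t] the weight has decreased, which helps as
long as the function was nonnegative there, so the only loss comes from the integral over [t, t₀].
-/
theorem mlDecay_sub_le {α q M t t₀ : ℝ} (hα : α ∈ Ioo (0 : ℝ) 1) (hq : 0 ≤ q) (ht : 0 ≤ t)
    (htt : t < t₀) (h0 : ∀ s ∈ Icc 0 t, 0 ≤ mlDecay α q s) (hM : 0 ≤ M)
    (hle : ∀ s ∈ Icc t t₀, mlDecay α q s ≤ M) :
    mlDecay α q t - q * (2 * M * (t₀ - t) ^ α / Real.Gamma (α + 1)) ≤ mlDecay α q t₀ := by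
  have ht₀ : 0 < t₀ := ht.trans_lt htt
  have hG1 : 0 < Real.Gamma (α + 1) := Real.Gamma_pos_of_pos (by linarith [hα.1])
  set W : ℝ → ℝ → ℝ := fun t s => mlKernel α q s * (rlKernel α (t - s) * t ^ (1 - α)) with hW
  have hWint : ∀ t, 0 < t → IntervalIntegrable (W t) volume 0 t := fun t ht => by
    have h := (intervalIntegrable_mlKernel_mul hα.1 ht q 0).mul_const (t ^ (1 - α))
    simp_rw [mlKernel_zero, mul_assoc] at h
    exact h
  have hsub1 : uIcc 0 t ⊆ uIcc 0 t₀ := by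
    rw [uIcc_of_le ht, uIcc_of_le ht₀.le]; exact Icc_subset_Icc_right htt.le
  have hsub2 : uIcc t t₀ ⊆ uIcc 0 t₀ := by
    rw [uIcc_of_le htt.le, uIcc_of_le ht₀.le]; exact Icc_subset_Icc_left ht
  have hi1 := (hWint t₀ ht₀).mono_set hsub1
  have hi2 := (hWint t₀ ht₀).mono_set hsub2
  have hsplit := intervalIntegral.integral_add_adjacent_intervals hi1 hi2
  have htail : ∫ s in t..t₀, W t₀ s ≤ 2 * M * (t₀ - t) ^ α / Real.Gamma (α + 1) := by
    have hr1 : IntervalIntegrable (fun s => rlKernel α (t₀ - s)) volume t t₀ := by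
      have := (intervalIntegrable_rlKernel hα.1 (t₀ - t) 0).comp_sub_left t₀
      simpa using this
    have hr2 := intervalIntegrable_rlKernel hα.1 t t₀
    calc ∫ s in t..t₀, W t₀ s ≤ ∫ s in t..t₀, M * (rlKernel α (t₀ - s) + rlKernel α s) := by
          refine intervalIntegral.integral_mono_on_of_le_Ioo htt.le hi2
            ((hr1.add hr2).const_mul M) fun s hs => ?_
          have hs0 : 0 < s := ht.trans_lt hs.1
          have hk : 0 ≤ rlKernel α (t₀ - s) * t₀ ^ (1 - α) :=
            mul_nonneg (rlKernel_nonneg hα.1 (sub_nonneg.2 hs.2.le)) (by positivity)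
          calc W t₀ s = mlDecay α q s *
                (s ^ (α - 1) * (rlKernel α (t₀ - s) * t₀ ^ (1 - α))) := by
                simp only [hW, mlKernel_eq]; ring
            _ ≤ M * (s ^ (α - 1) * (rlKernel α (t₀ - s) * t₀ ^ (1 - α))) := by
                gcongr
                exact hle s ⟨hs.1.le, hs.2.le⟩
            _ ≤ _ := by
                gcongr
                exact rpow_mul_weight_le hα hs0 hs.2
      _ = M * (((t₀ - t) ^ α + (t₀ ^ α - t ^ α)) / Real.Gamma (α + 1)) := by
          rw [intervalIntegral.integral_const_mul, intervalIntegral.integral_add hr1 hr2,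
            intervalIntegral.integral_comp_sub_left (rlKernel α) t₀, integral_rlKernel hα.1,
            integral_rlKernel hα.1, sub_self, Real.zero_rpow hα.1.ne', sub_zero, add_div]
      _ ≤ M * (((t₀ - t) ^ α + (t₀ - t) ^ α) / Real.Gamma (α + 1)) := by
          have := Real.rpow_add_le_add_rpow (sub_nonneg.2 htt.le) ht hα.1.le hα.2.le
          rw [sub_add_cancel] at this
          gcongr
          linarith
      _ = _ := by ring
  have hhead : mlDecay α q t ≤ 1 / Real.Gamma α - q * ∫ s in (0)..t, W t₀ s := by
    rcases ht.eq_or_lt with rfl | ht'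
    · rw [mlDecay_zero hα.1]; simp
    · rw [mlDecay_volterra hα.1 ht']
      gcongr
      refine intervalIntegral.integral_mono_on_of_le_Ioo ht hi1 (hWint t ht') fun s hs => ?_
      have : 0 ≤ mlKernel α q s :=
        mul_nonneg (Real.rpow_nonneg hs.1.le _) (h0 s ⟨hs.1.le, hs.2.le⟩)
      exact mul_le_mul_of_nonneg_left (rlKernel_weight_mono hα hs.1 hs.2 htt) this
  rw [mlDecay_volterra hα.1 ht₀, ← hsplit]
  have := mul_le_mul_of_nonneg_left htail hq
  linarith

/-- The step h is so short that at most half of the value is lost per step. -/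
theorem mlDecay_lower {α q h : ℝ} (hα : α ∈ Ioo (0 : ℝ) 1) (hq : 0 ≤ q) (hh : 0 < h)
    (hqh : q * (2 * h ^ α / Real.Gamma (α + 1)) ≤ 1 / 2) (N : ℕ) :
    ∀ t ∈ Icc 0 (N * h), (1 / 2) ^ N / Real.Gamma α ≤ mlDecay α q t := by
  have hG := Real.Gamma_pos_of_pos hα.1
  have hG1 : 0 < Real.Gamma (α + 1) := Real.Gamma_pos_of_pos (by linarith [hα.1])
  induction N with
  | zero =>
    intro t ht
    have : t = 0 := by simpa using ht
    rw [this, mlDecay_zero hα.1]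
    simp
  | succ N ih =>
    intro t₁ ht₁
    by_contra! hlt
    set c : ℝ := (1 / 2) ^ (N + 1) / Real.Gamma α with hc
    have hc0 : 0 < c := by positivity
    have hc2 : (1 / 2) ^ N / Real.Gamma α = 2 * c := by rw [hc, pow_succ]; ring
    rw [hc2] at ih
    -- A strictly positive level d < c makes the function positive up to its first time t₀ at or
    -- below d, as the comparison requires.
    obtain ⟨d, hd1, hd2⟩ := exists_between (max_lt hlt hc0)
    have hd0 : 0 < d := (le_max_right _ _).trans_lt hd1
    have hdt : mlDecay α q t₁ < d := (le_max_left _ _).trans_lt hd1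
    have hcont := continuous_mlDecay hα.1 q
    have hcpt : IsCompact {t ∈ Icc 0 t₁ | mlDecay α q t ≤ d} :=
      isCompact_Icc.inter_right (isClosed_le hcont continuous_const)
    obtain ⟨t₀, ht₀, hmin⟩ := hcpt.exists_isLeast ⟨t₁, ⟨ht₁.1, le_rfl⟩, hdt.le⟩
    have hpos : ∀ s ∈ Ico 0 t₀, d < mlDecay α q s := fun s hs => by
      by_contra! hs'
      exact absurd (hmin ⟨⟨hs.1, hs.2.le.trans ht₀.1.2⟩, hs'⟩) (not_le.2 hs.2)
    have hNt : (N : ℝ) * h < t₀ := by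
      by_contra! hle
      have := ih t₀ ⟨ht₀.1.1, hle⟩
      linarith [ht₀.2]
    have hN0 : 0 ≤ (N : ℝ) * h := by positivity
    -- Starting from the maximum point t, the upper bound M is the value at t itself. The loss up to
    -- t₀ is then at most half of that value, leaving at least c > d.
    obtain ⟨t, ht, htmax⟩ := isCompact_Icc.exists_isMaxOn (nonempty_Icc.2 hNt.le)
      hcont.continuousOn
    have h2c : 2 * c ≤ mlDecay α q t :=
      (ih _ ⟨hN0, le_rfl⟩).trans (htmax (left_mem_Icc.2 hNt.le))
    have htt : t < t₀ := lt_of_le_of_ne ht.2 fun h => by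
      rw [h] at h2c
      linarith [ht₀.2]
    have key := mlDecay_sub_le hα hq (hN0.trans ht.1) htt
      (fun s hs => hd0.le.trans (hpos s ⟨hs.1, hs.2.trans_lt htt⟩).le)
      (by linarith : 0 ≤ mlDecay α q t)
      fun s hs => htmax ⟨ht.1.trans hs.1, hs.2⟩
    have hlen : (t₀ - t) ^ α ≤ h ^ α := by
      have := ht₀.1.2.trans ht₁.2
      push_cast at this
      have := ht.1
      exact Real.rpow_le_rpow (by linarith) (by linarith) hα.1.le
    have h3 : q * (2 * mlDecay α q t * (t₀ - t) ^ α / Real.Gamma (α + 1)) ≤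
        mlDecay α q t * (1 / 2) := by
      calc q * (2 * mlDecay α q t * (t₀ - t) ^ α / Real.Gamma (α + 1))
          = mlDecay α q t * (q * (2 * (t₀ - t) ^ α / Real.Gamma (α + 1))) := by ring
        _ ≤ mlDecay α q t * (q * (2 * h ^ α / Real.Gamma (α + 1))) := by
            gcongr
            linarith
        _ ≤ _ := by gcongr; linarith
    linarith [ht₀.2]

theorem mlDecay_pos {α q t : ℝ} (hα : α ∈ Ioo (0 : ℝ) 1) (hq : 0 ≤ q) (ht : 0 ≤ t) :
    0 < mlDecay α q t := by
  have hG := Real.Gamma_pos_of_pos hα.1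
  have hG1 : 0 < Real.Gamma (α + 1) := Real.Gamma_pos_of_pos (by linarith [hα.1])
  obtain ⟨h, hh, hqh⟩ : ∃ h > 0, q * (2 * h ^ α / Real.Gamma (α + 1)) ≤ 1 / 2 := by
    -- The step h is chosen with h^α = y; the denominator q + 1 also covers q = 0.
    set y : ℝ := Real.Gamma (α + 1) / (4 * (q + 1)) with hy
    have hy0 : 0 < y := by positivity
    refine ⟨y ^ (1 / α), by positivity, ?_⟩
    rw [← Real.rpow_mul hy0.le, one_div_mul_cancel hα.1.ne', Real.rpow_one, hy]
    have : q * (2 * (Real.Gamma (α + 1) / (4 * (q + 1))) / Real.Gamma (α + 1)) =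
        q / (q + 1) * (1 / 2) := by field_simp; ring
    rw [this]
    have : q / (q + 1) ≤ 1 := (div_le_one (by linarith)).2 (by linarith)
    linarith
  obtain ⟨N, hN⟩ := exists_nat_ge (t / h)
  exact lt_of_lt_of_le (by positivity)
    (mlDecay_lower hα hq hh hqh N t ⟨ht, (div_le_iff₀ hh).1 hN⟩)

theorem mlKernel_pos {α q r : ℝ} (hα : α ∈ Ioo (0 : ℝ) 1) (hq : 0 ≤ q) (hr : 0 < r) :
    0 < mlKernel α q r :=
  mul_pos (Real.rpow_pos_of_pos hr _) (mlDecay_pos hα hq hr.le)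

/-- In the resolvent identity against rate 0 the convolution is nonnegative. -/
theorem mlKernel_le_rlKernel {α q r : ℝ} (hα : α ∈ Ioo (0 : ℝ) 1) (hq : 0 ≤ q) (hr : 0 < r) :
    mlKernel α q r ≤ rlKernel α r := by
  have h := integral_mlKernel_mul hα.1 hr q 0
  simp_rw [mlKernel_zero, sub_zero] at h
  have h2 : 0 ≤ ∫ s in (0)..r, mlKernel α q s * rlKernel α (r - s) := by
    rw [intervalIntegral.integral_of_le hr.le, integral_Ioc_eq_integral_Ioo]
    exact setIntegral_nonneg measurableSet_Ioo fun s hs =>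
      mul_nonneg (mlKernel_pos hα hq hs.1).le (rlKernel_nonneg hα.1 (sub_nonneg.2 hs.2.le))
  nlinarith [mul_nonneg hq h2]

/-! ### Laplace transform and total mass. -/

theorem integrableOn_exp_mul_rlKernel {α s : ℝ} (hα : 0 < α) (hs : 0 < s) :
    IntegrableOn (fun r => Real.exp (-(s * r)) * rlKernel α r) (Ioi 0) := by
  have h := integrableOn_rpow_mul_exp_neg_mul_rpow (s := α - 1) (p := 1) (b := s)
    (by linarith) one_pos hs
  refine IntegrableOn.congr_fun (h.div_const (Real.Gamma α)) (fun r _ => ?_) measurableSet_Ioi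
  simp only [rlKernel, Real.rpow_one, neg_mul]
  ring

theorem integral_exp_mul_rlKernel {α s : ℝ} (hα : 0 < α) (hs : 0 < s) :
    ∫ r in Ioi 0, Real.exp (-(s * r)) * rlKernel α r = 1 / s ^ α := by
  have hG := Real.Gamma_pos_of_pos hα
  have h := Real.integral_rpow_mul_exp_neg_mul_Ioi hα hs
  have e : ∀ r : ℝ, Real.exp (-(s * r)) * rlKernel α r =
      r ^ (α - 1) * Real.exp (-(s * r)) / Real.Gamma α := fun r => by
    rw [rlKernel]; ring
  simp_rw [e]
  rw [integral_div, h, Real.div_rpow zero_le_one hs.le, Real.one_rpow]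
  field_simp

theorem integrableOn_exp_mul_mlKernel {α q s : ℝ} (hα : α ∈ Ioo (0 : ℝ) 1) (hq : 0 ≤ q)
    (hs : 0 < s) : IntegrableOn (fun r => Real.exp (-(s * r)) * mlKernel α q r) (Ioi 0) := by
  refine Integrable.mono' (integrableOn_exp_mul_rlKernel hα.1 hs) ?_ ?_
  · refine ContinuousOn.aestronglyMeasurable ?_ measurableSet_Ioi
    exact (Continuous.continuousOn (by fun_prop)).mul (continuousOn_mlKernel hα.1 q)
  · filter_upwards [ae_restrict_mem measurableSet_Ioi] with r hr
    rw [Real.norm_of_nonneg (mul_nonneg (Real.exp_pos _).le (mlKernel_pos hα hq hr).le)]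
    gcongr
    exact mlKernel_le_rlKernel hα hq hr

/-- The Laplace transform of the relaxation kernel. -/
theorem integral_exp_mul_mlKernel {α q s : ℝ} (hα : α ∈ Ioo (0 : ℝ) 1) (hq : 0 ≤ q)
    (hs : 0 < s) :
    ∫ r in Ioi 0, Real.exp (-(s * r)) * mlKernel α q r = 1 / (s ^ α + q) := by
  -- The Laplace transform turns the resolvent identity against rate 0 into the linear equation q F
  -- / s^α = 1 / s^α - F.
  have h := integral_posConvolution (integrableOn_exp_mul_mlKernel hα hq hs)
    (integrableOn_exp_mul_rlKernel hα.1 hs) (ContinuousLinearMap.mul ℝ ℝ)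
  simp only [ContinuousLinearMap.mul_apply', integral_exp_mul_rlKernel hα.1 hs] at h
  set F := ∫ r in Ioi 0, Real.exp (-(s * r)) * mlKernel α q r with hF
  have e : ∀ x ∈ Ioi (0 : ℝ), q * (∫ t in (0)..x, Real.exp (-(s * t)) * mlKernel α q t *
      (Real.exp (-(s * (x - t))) * rlKernel α (x - t))) =
      Real.exp (-(s * x)) * rlKernel α x - Real.exp (-(s * x)) * mlKernel α q x := by
    intro x hx
    have h1 := integral_mlKernel_mul hα.1 hx q 0
    simp_rw [mlKernel_zero, sub_zero] at h1
    rw [← mul_sub, ← h1, mul_left_comm, ← intervalIntegral.integral_const_mul (Real.exp _)]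
    congr 2
    funext t
    have : Real.exp (-(s * x)) = Real.exp (-(s * t)) * Real.exp (-(s * (x - t))) := by
      rw [← Real.exp_add]; congr 1; ring
    rw [this]
    ring
  have h2 : q * (F * (1 / s ^ α)) = 1 / s ^ α - F := by
    rw [← h, ← integral_const_mul, setIntegral_congr_fun measurableSet_Ioi e,
      integral_sub (integrableOn_exp_mul_rlKernel hα.1 hs) (integrableOn_exp_mul_mlKernel hα hq hs),
      integral_exp_mul_rlKernel hα.1 hs]
  have hsα : 0 < s ^ α := Real.rpow_pos_of_pos hs _
  field_simp at h2 ⊢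
  linarith

/-- On (0, b] the kernel is at most e times its product with exp(-r/b), so its integral is bounded
by e times the Laplace transform at 1/b, hence by e/q for every b. -/
theorem integrableOn_mlKernel {α q : ℝ} (hα : α ∈ Ioo (0 : ℝ) 1) (hq : 0 < q) :
    IntegrableOn (mlKernel α q) (Ioi 0) := by
  have hloc : ∀ b : ℝ, IntegrableOn (mlKernel α q) (Ioc 0 b) := fun b => by
    rcases le_or_gt b 0 with hb | hb
    · simp [Ioc_eq_empty (not_lt.2 hb)]
    · refine Integrable.mono' (intervalIntegrable_rlKernel hα.1 0 b).1 ?_ ?_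
      · exact ((continuousOn_mlKernel hα.1 q).mono Ioc_subset_Ioi_self).aestronglyMeasurable
          measurableSet_Ioc
      · filter_upwards [ae_restrict_mem measurableSet_Ioc] with r hr
        rw [Real.norm_of_nonneg (mlKernel_pos hα hq.le hr.1).le]
        exact mlKernel_le_rlKernel hα hq.le hr.1
  refine integrableOn_Ioi_of_intervalIntegral_norm_bounded (l := Filter.atTop)
    (b := fun b : ℝ => b) (Real.exp 1 * (1 / q)) 0 hloc Filter.tendsto_id ?_
  filter_upwards [Filter.eventually_gt_atTop (0 : ℝ)] with b hb
  rw [intervalIntegral.integral_of_le hb.le]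
  have hb' : 0 < 1 / b := by positivity
  have hI := (integrableOn_exp_mul_mlKernel hα hq.le hb').const_mul (Real.exp 1)
  calc ∫ r in Ioc 0 b, ‖mlKernel α q r‖
      ≤ ∫ r in Ioc 0 b, Real.exp 1 * (Real.exp (-(1 / b * r)) * mlKernel α q r) := by
        refine setIntegral_mono_on (hloc b).norm (IntegrableOn.mono_set hI Ioc_subset_Ioi_self)
          measurableSet_Ioc fun r hr => ?_
        have hp := mlKernel_pos hα hq.le hr.1
        rw [Real.norm_of_nonneg hp.le, ← mul_assoc, ← Real.exp_add]
        have : 1 / b * r ≤ 1 := by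
          rw [one_div_mul_eq_div]
          exact (div_le_one hb).2 hr.2
        nlinarith [Real.one_le_exp (by linarith : 0 ≤ 1 + -(1 / b * r))]
    _ ≤ ∫ r in Ioi 0, Real.exp 1 * (Real.exp (-(1 / b * r)) * mlKernel α q r) := by
        refine setIntegral_mono_set hI ?_ Ioc_subset_Ioi_self.eventuallyLE
        filter_upwards [ae_restrict_mem measurableSet_Ioi] with r hr
        have := mlKernel_pos hα hq.le hr
        positivity
    _ = Real.exp 1 * (1 / ((1 / b) ^ α + q)) := by
        rw [integral_const_mul, integral_exp_mul_mlKernel hα hq.le hb']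
    _ ≤ Real.exp 1 * (1 / q) := by
        gcongr
        have : 0 < (1 / b) ^ α := Real.rpow_pos_of_pos hb' _
        linarith

/-- Let s → 0+ in the Laplace transform, with the kernel itself as majorant. -/
theorem integral_mlKernel {α q : ℝ} (hα : α ∈ Ioo (0 : ℝ) 1) (hq : 0 < q) :
    ∫ r in Ioi 0, mlKernel α q r = 1 / q := by
  have hcont : Filter.Tendsto (fun s : ℝ => ∫ r in Ioi 0, Real.exp (-(s * r)) * mlKernel α q r)
      (nhdsWithin 0 (Ioi 0)) (nhds (∫ r in Ioi 0, mlKernel α q r)) := by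
    refine tendsto_integral_filter_of_dominated_convergence (mlKernel α q) ?_ ?_
      (integrableOn_mlKernel hα hq) ?_
    · refine Filter.Eventually.of_forall fun s => ?_
      refine ContinuousOn.aestronglyMeasurable ?_ measurableSet_Ioi
      exact (Continuous.continuousOn (by fun_prop)).mul (continuousOn_mlKernel hα.1 q)
    · filter_upwards [self_mem_nhdsWithin] with s hs
      filter_upwards [ae_restrict_mem measurableSet_Ioi] with r hr
      have hp := mlKernel_pos hα hq.le hr
      rw [Real.norm_of_nonneg (by positivity)]
      refine mul_le_of_le_one_left hp.le (Real.exp_le_one_iff.2 ?_)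
      have := mul_pos (mem_Ioi.1 hs) (mem_Ioi.1 hr)
      linarith
    · refine Filter.Eventually.of_forall fun r => ?_
      have : Filter.Tendsto (fun s : ℝ => Real.exp (-(s * r)) * mlKernel α q r) (nhds 0)
          (nhds (Real.exp (-(0 * r)) * mlKernel α q r)) :=
        Continuous.tendsto (by fun_prop) 0
      simpa using this.mono_left nhdsWithin_le_nhds
  have h2 : Filter.Tendsto (fun s : ℝ => 1 / (s ^ α + q)) (nhdsWithin 0 (Ioi 0))
      (nhds (1 / q)) := by
    have : ContinuousAt (fun s : ℝ => 1 / (s ^ α + q)) 0 := by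
      refine ContinuousAt.div continuousAt_const ?_ ?_
      · exact (Real.continuous_rpow_const hα.1.le).continuousAt.add continuousAt_const
      · rw [Real.zero_rpow hα.1.ne']; simpa using hq.ne'
    have h := this.tendsto.mono_left (nhdsWithin_le_nhds (s := Ioi 0))
    simpa [Real.zero_rpow hα.1.ne'] using h
  refine tendsto_nhds_unique (hcont.congr' ?_) h2
  filter_upwards [self_mem_nhdsWithin] with s hs
  exact integral_exp_mul_mlKernel hα hq.le hs

/-! ### Bounds uniform in the order α. -/

/-- Convexity of Γ: the chord on [1, 2] gives the upper bound. The chord on [2, 3] gives Γ(3 - α) ≤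
2 - α, and the midpoint inequality at 2 between α + 1 and 3 - α gives the lower one. -/
theorem Gamma_add_one_mem_Icc {α : ℝ} (hα : α ∈ Ioo (0 : ℝ) 1) :
    Real.Gamma (α + 1) ∈ Icc α 1 := by
  have hc := Real.convexOn_Gamma.2
  have hG3 : Real.Gamma 3 = 2 := by
    have := Real.Gamma_nat_eq_factorial 2
    have e : ((2 : ℕ) : ℝ) + 1 = 3 := by norm_num
    rw [e] at this
    rw [this]
    norm_num [Nat.factorial]
  have h1 := hc (x := 1) (by simp) (y := 2) (by simp) (a := 1 - α) (b := α) (by linarith [hα.2])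
    hα.1.le (by ring)
  have h2 := hc (x := 2) (by simp) (y := 3) (by simp) (a := α) (b := 1 - α) hα.1.le
    (by linarith [hα.2]) (by ring)
  have h3 := hc (x := α + 1) (by simp only [mem_Ioi]; linarith [hα.1]) (y := 3 - α)
    (by simp only [mem_Ioi]; linarith [hα.2]) (a := 1 / 2) (b := 1 / 2) (by norm_num)
    (by norm_num) (by norm_num)
  simp only [smul_eq_mul, Real.Gamma_one, Real.Gamma_two, hG3] at h1 h2 h3
  have e1 : (1 - α) * 1 + α * 2 = α + 1 := by ring
  have e2 : α * 2 + (1 - α) * 3 = 3 - α := by ring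
  have e3 : 1 / 2 * (α + 1) + 1 / 2 * (3 - α) = 2 := by ring
  rw [e1] at h1
  rw [e2] at h2
  rw [e3, Real.Gamma_two] at h3
  constructor <;> linarith

/-- Writing B(α) = 1 - α + α² / Γ(α + 1), the bounds on Γ(α + 1) give 1 - α + α² ≤ B(α) ≤ 1. -/
theorem abNorm_mem_Icc {α : ℝ} (hα : α ∈ Ioo (0 : ℝ) 1) : abNorm α ∈ Icc (3 / 4) 1 := by
  have hG := Real.Gamma_pos_of_pos hα.1
  have h := Gamma_add_one_mem_Icc hα
  have hα0 := hα.1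
  have e : abNorm α = 1 - α + α * α / Real.Gamma (α + 1) := by
    rw [abNorm, Real.Gamma_add_one hα.1.ne']
    field_simp
  have hG1 : 0 < Real.Gamma (α + 1) := hα.1.trans_le h.1
  rw [e]
  constructor
  · have : α * α ≤ α * α / Real.Gamma (α + 1) := by
      rw [le_div_iff₀ hG1]
      nlinarith [h.2, mul_pos hα.1 hα.1]
    nlinarith [sq_nonneg (α - 1 / 2)]
  · have : α * α / Real.Gamma (α + 1) ≤ α := by
      rw [div_le_iff₀ hG1]
      nlinarith [h.1, hα.1]
    linarith

/-- A lower bound of the relaxation kernel on `(0, 2]`, uniform in the order `α ∈ [α₀, 1)` and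
in the rate `q ∈ [0, Q]`. -/
theorem exists_mlKernel_lower {α₀ : ℝ} (hα₀ : 0 < α₀) {Q : ℝ} (hQ : 0 < Q) :
    ∃ g₀ > 0, ∀ α ∈ Ioo (0 : ℝ) 1, α₀ ≤ α → ∀ q ∈ Icc 0 Q, ∀ r ∈ Ioc (0 : ℝ) 2,
      g₀ ≤ mlKernel α q r := by
  -- The cap at 1 gives h ≤ 1, hence h^α ≤ h^α₀ = y: a single step length halves at worst for all α
  -- ≥ α₀ and q ≤ Q.
  set y : ℝ := min 1 (α₀ / (4 * Q)) with hy
  have hy0 : 0 < y := lt_min one_pos (by positivity)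
  set h : ℝ := y ^ (1 / α₀) with hh
  have hh0 : 0 < h := Real.rpow_pos_of_pos hy0 _
  have hh1 : h ≤ 1 := Real.rpow_le_one hy0.le (min_le_left _ _) (by positivity)
  obtain ⟨N, hN⟩ := exists_nat_ge (2 / h)
  refine ⟨1 / 2 * ((1 / 2) ^ N * α₀), by positivity, fun α hα hαα q hq r hr => ?_⟩
  have hG := Gamma_add_one_mem_Icc hα
  have hGp : 0 < Real.Gamma (α + 1) := hα.1.trans_le hG.1
  have hG0 := Real.Gamma_pos_of_pos hα.1
  have hhα : h ^ α ≤ α₀ / (4 * Q) := by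
    calc h ^ α ≤ h ^ α₀ := Real.rpow_le_rpow_of_exponent_ge hh0 hh1 hαα
      _ = y := by rw [hh, ← Real.rpow_mul hy0.le, one_div_mul_cancel hα₀.ne', Real.rpow_one]
      _ ≤ _ := min_le_right _ _
  have hqh : q * (2 * h ^ α / Real.Gamma (α + 1)) ≤ 1 / 2 := by
    calc q * (2 * h ^ α / Real.Gamma (α + 1)) ≤ Q * (2 * (α₀ / (4 * Q)) / α₀) := by
          have : α₀ ≤ Real.Gamma (α + 1) := hαα.trans hG.1
          have := hq.1
          have := hq.2
          gcongr
      _ = 1 / 2 := by field_simp; norm_num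
  have hd := mlDecay_lower hα hq.1 hh0 hqh N r ⟨hr.1.le, hr.2.trans ((div_le_iff₀ hh0).1 hN)⟩
  have h1 : 1 / 2 ≤ r ^ (α - 1) := by
    calc (1 / 2 : ℝ) = 2 ^ (-1 : ℝ) := by rw [Real.rpow_neg_one]; norm_num
      _ ≤ 2 ^ (α - 1) := Real.rpow_le_rpow_of_exponent_le (by norm_num) (by linarith [hα.1])
      _ ≤ r ^ (α - 1) := Real.rpow_le_rpow_of_nonpos hr.1 hr.2 (by linarith [hα.2])
  have h2 : α₀ ≤ 1 / Real.Gamma α := by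
    rw [le_div_iff₀ hG0]
    have := hG.2
    rw [Real.Gamma_add_one hα.1.ne'] at this
    nlinarith
  rw [mlKernel_eq]
  have h3 : (1 / 2) ^ N * α₀ ≤ mlDecay α q r := by
    refine le_trans ?_ hd
    rw [div_eq_mul_one_div ((1 / 2 : ℝ) ^ N)]
    exact mul_le_mul_of_nonneg_left h2 (by positivity)
  exact mul_le_mul h1 h3 (by positivity) (by linarith)

/-! ### The time operator and the time barrier. -/

/-- The relaxation kernel extended by zero to the negative half-line. -/
noncomputable def mlKernelPos (α q : ℝ) : ℝ → ℝ := (Ioi 0).indicator (mlKernel α q)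

theorem integrable_mlKernelPos {α q : ℝ} (hα : α ∈ Ioo (0 : ℝ) 1) (hq : 0 < q) :
    Integrable (mlKernelPos α q) :=
  (integrable_indicator_iff measurableSet_Ioi).2 (integrableOn_mlKernel hα hq)

theorem integral_mlKernelPos {α q : ℝ} (hα : α ∈ Ioo (0 : ℝ) 1) (hq : 0 < q) :
    ∫ r, mlKernelPos α q r = 1 / q := by
  rw [mlKernelPos, integral_indicator measurableSet_Ioi, integral_mlKernel hα hq]

theorem mlKernelPos_nonneg {α q : ℝ} (hα : α ∈ Ioo (0 : ℝ) 1) (hq : 0 ≤ q) (r : ℝ) :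
    0 ≤ mlKernelPos α q r :=
  indicator_nonneg (fun _ hr => (mlKernel_pos hα hq hr).le) r

theorem convolution_mlKernelPos {α p q : ℝ} (hα : α ∈ Ioo (0 : ℝ) 1) (hpq : p ≠ q) :
    convolution (mlKernelPos α p) (mlKernelPos α q) (ContinuousLinearMap.mul ℝ ℝ) volume =
      fun r => (mlKernelPos α q r - mlKernelPos α p r) / (p - q) := by
  have h := posConvolution_eq_convolution_indicator (mlKernel α p) (mlKernel α q)
    (ContinuousLinearMap.mul ℝ ℝ) volume
  unfold mlKernelPos
  rw [← h]
  funext r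
  rw [posConvolution]
  by_cases hr : r ∈ Ioi (0 : ℝ)
  · simp only [indicator_of_mem hr, ContinuousLinearMap.mul_apply']
    rw [eq_div_iff (sub_ne_zero.2 hpq), mul_comm]
    exact integral_mlKernel_mul hα.1 hr p q
  · simp [indicator_of_notMem hr]

theorem convolution_convolution_mlKernelPos {α p q : ℝ} (hα : α ∈ Ioo (0 : ℝ) 1) (hp : 0 < p)
    (hq : 0 < q) (hpq : p ≠ q) {f : ℝ → ℝ} (hf : Continuous f) (hc : HasCompactSupport f) (t : ℝ) :
    convolution (convolution f (mlKernelPos α p) (ContinuousLinearMap.mul ℝ ℝ) volume)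
      (mlKernelPos α q) (ContinuousLinearMap.mul ℝ ℝ) volume t =
    (convolution f (mlKernelPos α q) (ContinuousLinearMap.mul ℝ ℝ) volume t -
      convolution f (mlKernelPos α p) (ContinuousLinearMap.mul ℝ ℝ) volume t) / (p - q) := by
  have ip := integrable_mlKernelPos hα hp
  have iq := integrable_mlKernelPos hα hq
  have h := convolution_assoc (ContinuousLinearMap.mul ℝ ℝ) (ContinuousLinearMap.mul ℝ ℝ)
    (ContinuousLinearMap.mul ℝ ℝ) (ContinuousLinearMap.mul ℝ ℝ) (μ := volume) (ν := volume)
    (f := f) (g := mlKernelPos α p) (k := mlKernelPos α q) (fun x y z => by simp [mul_assoc])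
    (x₀ := t) hf.aestronglyMeasurable ip.aestronglyMeasurable iq.aestronglyMeasurable
    (Filter.Eventually.of_forall fun y =>
      hc.convolutionExists_left _ hf ip.locallyIntegrable y)
    (ip.norm.ae_convolution_exists _ iq.norm)
    (hc.norm.convolutionExists_left _ hf.norm
      (ip.norm.integrable_convolution _ iq.norm).locallyIntegrable t)
  rw [h, convolution_mlKernelPos hα hpq]
  simp only [convolution_def, ContinuousLinearMap.mul_apply']
  have e1 : Integrable fun s => f s * mlKernelPos α p (t - s) :=
    hc.convolutionExists_left (ContinuousLinearMap.mul ℝ ℝ) hf ip.locallyIntegrable t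
  have e2 : Integrable fun s => f s * mlKernelPos α q (t - s) :=
    hc.convolutionExists_left (ContinuousLinearMap.mul ℝ ℝ) hf iq.locallyIntegrable t
  rw [← integral_sub e2 e1, ← integral_div]
  congr 1
  funext s
  ring

theorem setIntegral_Iio_eq_Ioi (h : ℝ → ℝ) (t : ℝ) :
    ∫ s in Iio t, h s = ∫ r in Ioi 0, h (t - r) := by
  rw [← integral_indicator measurableSet_Iio, ← integral_indicator measurableSet_Ioi,
    ← integral_sub_left_eq_self _ volume t]
  congr 1
  funext r
  by_cases hr : 0 < r <;> simp [indicator, hr]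

theorem integrableOn_Iio_mul_mlKernel {α q : ℝ} (hα : α ∈ Ioo (0 : ℝ) 1) (hq : 0 < q) {g : ℝ → ℝ}
    {t C : ℝ} (hg : AEStronglyMeasurable g (volume.restrict (Iio t)))
    (hC : ∀ s < t, |g s| ≤ C) :
    IntegrableOn (fun s => g s * mlKernel α q (t - s)) (Iio t) := by
  have h1 : IntegrableOn (fun s => mlKernel α q (t - s)) (Iio t) := by
    have := (integrable_mlKernelPos hα hq).comp_sub_left t
    rw [← integrable_indicator_iff measurableSet_Iio]
    refine this.congr (Filter.Eventually.of_forall fun s => ?_)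
    simp [mlKernelPos, indicator]
  refine Integrable.bdd_mul h1 hg (c := C) ?_
  filter_upwards [ae_restrict_mem measurableSet_Iio] with s hs
  exact hC s hs

/-- The fractional time derivative of a function of time only. -/
noncomputable def timeOp (α : ℝ) (m : ℝ → ℝ) (t : ℝ) : ℝ :=
  abConst α * ∫ s in Iio t, (m t - m s) * abKernel α (t - s)

theorem abConst_eq (α : ℝ) : abConst α = α / (1 - α) * (abNorm α / (1 - α)) := by
  rw [abConst, abRate, neg_neg]

theorem abConst_pos {α : ℝ} (hα : α ∈ Ioo (0 : ℝ) 1) : 0 < abConst α := by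
  rw [abConst_eq]
  have h1 : 0 < 1 - α := by linarith [hα.2]
  have h2 : 0 < abNorm α := by linarith [(abNorm_mem_Icc hα).1]
  have := hα.1
  positivity

/-- With κ = α / (1 - α) the eigenvalue is c_α (1/κ - 1/(1 + κ)), which collapses to B(α). -/
theorem timeOp_exp {α : ℝ} (hα : α ∈ Ioo (0 : ℝ) 1) (δ t : ℝ) :
    timeOp α (fun s => δ * Real.exp s) t = abNorm α * (δ * Real.exp t) := by
  have h1 : 0 < 1 - α := by linarith [hα.2]
  have hα0 := hα.1
  have hκ : 0 < α / (1 - α) := by positivity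
  have e : ∀ r : ℝ, (δ * Real.exp t - δ * Real.exp (t - r)) * abKernel α (t - (t - r)) =
      δ * Real.exp t * (mlKernel α (α / (1 - α)) r -
        Real.exp (-(1 * r)) * mlKernel α (α / (1 - α)) r) := fun r => by
    rw [sub_sub_cancel, abKernel_eq_mlKernel, sub_eq_add_neg t r, Real.exp_add, one_mul]
    ring
  rw [timeOp, setIntegral_Iio_eq_Ioi]
  simp_rw [e]
  rw [integral_const_mul, integral_sub (integrableOn_mlKernel hα hκ)
    (integrableOn_exp_mul_mlKernel hα hκ.le one_pos), integral_mlKernel hα hκ,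
    integral_exp_mul_mlKernel hα hκ.le one_pos, Real.one_rpow, abConst_eq]
  have : 1 - α + α = 1 := by ring
  field_simp
  rw [this]
  ring

theorem timeOp_eq_convolution {α : ℝ} (hα : α ∈ Ioo (0 : ℝ) 1) {m : ℝ → ℝ} (hm : Continuous m)
    {C : ℝ} (hC : ∀ s, |m s| ≤ C) (t : ℝ) :
    timeOp α m t = abConst α * (m t * ((1 - α) / α) -
      convolution m (mlKernelPos α (α / (1 - α))) (ContinuousLinearMap.mul ℝ ℝ) volume t) := by
  have h1 : 0 < 1 - α := by linarith [hα.2]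
  have hα0 := hα.1
  have hκ : 0 < α / (1 - α) := by positivity
  simp only [timeOp, abKernel_eq_mlKernel, sub_mul, convolution_def,
    ContinuousLinearMap.mul_apply']
  rw [integral_sub
    (integrableOn_Iio_mul_mlKernel hα hκ (C := |m t|) aestronglyMeasurable_const
      fun s _ => le_rfl)
    (integrableOn_Iio_mul_mlKernel hα hκ hm.aestronglyMeasurable fun s _ => hC s)]
  congr 2
  · rw [integral_const_mul, setIntegral_Iio_eq_Ioi]
    simp only [sub_sub_cancel]
    rw [integral_mlKernel hα hκ, one_div_div]
  · rw [← integral_indicator measurableSet_Iio]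
    congr 1
    funext s
    by_cases hs : s < t <;> simp [mlKernelPos, indicator, hs]

/-- A smooth solution `m` of `ℒ m + C₁ m = f` for a smooth pulse `f ≥ 0` in `[-2, -1]`; it is
bounded from below after the pulse, uniformly in the order. -/
theorem exists_time_barrier {α₀ : ℝ} (hα₀ : 0 < α₀) {C₁ : ℝ} (hC₁ : 0 < C₁) :
    ∃ θ₁ > 0, ∀ α ∈ Ico α₀ 1, ∀ f : ℝ → ℝ, ContDiff ℝ ((⊤ : ℕ∞) : WithTop ℕ∞) f →
      (∀ t, 0 ≤ f t) → (∀ t ∉ Ioo (-2 : ℝ) (-1), f t = 0) → ∀ F : ℝ, (∀ t, f t ≤ F) →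
      ∃ m : ℝ → ℝ, ContDiff ℝ ((⊤ : ℕ∞) : WithTop ℕ∞) m ∧ (∀ t, 0 ≤ m t) ∧
        (∀ t, m t ≤ F / C₁) ∧ (∀ t ≤ -2, m t = 0) ∧
        (∀ t ∈ Icc (-1 : ℝ) 0, θ₁ * ∫ s, f s ≤ m t) ∧
        ∀ t, timeOp α m t + C₁ * m t = f t := by
  obtain ⟨g₀, hg₀, hg⟩ := exists_mlKernel_lower hα₀ (Q := C₁ * (4 / 3)) (by positivity)
  refine ⟨α₀ * (3 / 4) / (1 + C₁) ^ 2 * g₀, by positivity, ?_⟩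
  intro α hαm f hf hf0 hfs F hF
  have hα : α ∈ Ioo (0 : ℝ) 1 := ⟨hα₀.trans_le hαm.1, hαm.2⟩
  have hα0 := hα.1
  have hd : 0 < 1 - α := by linarith [hα.2]
  obtain ⟨hB1, hB2⟩ := abNorm_mem_Icc hα
  have hB0 : 0 < abNorm α := by linarith
  set κ := α / (1 - α) with hκ
  have hκ0 : 0 < κ := by positivity
  set K := abNorm α / (1 - α) with hK
  have hK0 : 0 < K := by positivity
  have hcα : abConst α = κ * K := abConst_eq α
  -- The Laplace symbol of ℒ is K s^α / (s^α + κ). Inverting ℒ + C₁ gives (K + C₁)⁻¹ (1 + (κ - q) /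
  -- (s^α + q)) with this q, and b below is (κ - q) / (K + C₁).
  set q := C₁ * κ / (K + C₁) with hq
  have hq0 : 0 < q := by positivity
  have hκq : q < κ := by
    rw [hq, div_lt_iff₀ (by positivity)]
    nlinarith [mul_pos hκ0 hK0]
  set b := κ * K / (K + C₁) ^ 2 with hb
  have hb0 : 0 < b := by positivity
  -- Clearing 1 - α shows that q stays bounded and b stays away from 0, although κ and K blow up as
  -- α → 1.
  have hden : K + C₁ = (abNorm α + C₁ * (1 - α)) / (1 - α) := by
    rw [hK]; field_simp
  have hd1 : 0 < abNorm α + C₁ * (1 - α) := by positivity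
  have hqQ : q ≤ C₁ * (4 / 3) := by
    have : q = C₁ * α / (abNorm α + C₁ * (1 - α)) := by
      rw [hq, hden, hκ]; field_simp
    rw [this, div_le_iff₀ hd1]
    have h1 : C₁ * α ≤ C₁ * 1 := by gcongr; exact hα.2.le
    have h2 : C₁ * 1 ≤ C₁ * (4 / 3) * (abNorm α + C₁ * (1 - α)) := by
      rw [mul_assoc]
      gcongr
      have := mul_pos hC₁ hd
      linarith
    linarith
  have hbl : α₀ * (3 / 4) / (1 + C₁) ^ 2 ≤ b := by
    have : b = α * abNorm α / (abNorm α + C₁ * (1 - α)) ^ 2 := by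
      rw [hb, hden, hκ, hK]; field_simp
    rw [this]
    have := hαm.1
    gcongr
    nlinarith
  have hc : HasCompactSupport f :=
    HasCompactSupport.intro (isCompact_Icc (a := (-2 : ℝ)) (b := -1)) fun t ht =>
      hfs t fun h => ht (Ioo_subset_Icc_self h)
  have hfc : Continuous f := hf.continuous
  have ik := integrable_mlKernelPos hα hq0
  have iκ := integrable_mlKernelPos hα hκ0
  set k := convolution f (mlKernelPos α q) (ContinuousLinearMap.mul ℝ ℝ) volume with hk
  have hkd : ContDiff ℝ ((⊤ : ℕ∞) : WithTop ℕ∞) k :=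
    hc.contDiff_convolution_left _ hf ik.locallyIntegrable
  have hkint : ∀ t, Integrable fun s => f s * mlKernelPos α q (t - s) := fun t =>
    hc.convolutionExists_left (ContinuousLinearMap.mul ℝ ℝ) hfc ik.locallyIntegrable t
  have hkv : ∀ t, k t = ∫ s, f s * mlKernelPos α q (t - s) := fun t => rfl
  have hF0 : 0 ≤ F := (hf0 0).trans (hF 0)
  have hk0 : ∀ t, 0 ≤ k t := fun t => by
    rw [hkv]
    exact integral_nonneg fun s => mul_nonneg (hf0 s) (mlKernelPos_nonneg hα hq0.le _)
  have hkF : ∀ t, k t ≤ F / q := fun t => by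
    rw [hkv]
    calc ∫ s, f s * mlKernelPos α q (t - s) ≤ ∫ s, F * mlKernelPos α q (t - s) := by
          refine integral_mono (hkint t) ((ik.comp_sub_left t).const_mul F) fun s => ?_
          exact mul_le_mul_of_nonneg_right (hF s) (mlKernelPos_nonneg hα hq0.le _)
      _ = F / q := by
          rw [integral_const_mul, integral_sub_left_eq_self (mlKernelPos α q),
            integral_mlKernelPos hα hq0, mul_one_div]
  have hm0 : ∀ t, 0 ≤ f t / (K + C₁) + b * k t := fun t => by
    have := hf0 t
    have := hk0 t
    positivity
  -- Since b/q = K / (C₁ (K + C₁)), the two bounds add up to exactly F / C₁.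
  have hmF : ∀ t, f t / (K + C₁) + b * k t ≤ F / C₁ := fun t => by
    calc f t / (K + C₁) + b * k t ≤ F / (K + C₁) + b * (F / q) := by
          gcongr
          · exact hF t
          · exact hkF t
      _ = F / C₁ := by
          rw [hb, hq]
          field_simp
          ring
  refine ⟨fun t => f t / (K + C₁) + b * k t, ?_, hm0, hmF, ?_, ?_, ?_⟩
  · exact (hf.div_const _).add (contDiff_const.mul hkd)
  · intro t ht
    have h1 : f t = 0 := hfs t fun h => absurd h.1 (not_lt.2 ht)
    have h2 : k t = 0 := by
      rw [hkv, ← integral_zero ℝ ℝ]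
      congr 1
      funext s
      by_cases hs : s ∈ Ioo (-2 : ℝ) (-1)
      · have : t - s ∉ Ioi (0 : ℝ) := by
          simp only [mem_Ioi, not_lt]; linarith [hs.1]
        rw [mlKernelPos, indicator_of_notMem this, mul_zero]
      · rw [hfs s hs, zero_mul]
    simp [h1, h2]
  · intro t ht
    have h1 : g₀ * ∫ s, f s ≤ k t := by
      rw [hkv, ← integral_const_mul]
      refine integral_mono ((hfc.integrable_of_hasCompactSupport hc).const_mul _) (hkint t)
        fun s => ?_
      by_cases hs : s ∈ Ioo (-2 : ℝ) (-1)
      · have hts : t - s ∈ Ioc (0 : ℝ) 2 := ⟨by linarith [hs.2, ht.1], by linarith [hs.1, ht.2]⟩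
        have h3 := hg α hα hαm.1 q ⟨hq0.le, hqQ⟩ (t - s) hts
        rw [mlKernelPos, indicator_of_mem (mem_Ioi.2 hts.1), mul_comm]
        exact mul_le_mul_of_nonneg_left h3 (hf0 s)
      · simp [hfs s hs]
    have h2 : 0 ≤ f t / (K + C₁) := div_nonneg (hf0 t) (by positivity)
    have h3 : 0 ≤ ∫ s, f s := integral_nonneg hf0
    calc α₀ * (3 / 4) / (1 + C₁) ^ 2 * g₀ * ∫ s, f s
        = α₀ * (3 / 4) / (1 + C₁) ^ 2 * (g₀ * ∫ s, f s) := by ring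
      _ ≤ b * k t := mul_le_mul hbl h1 (by positivity) hb0.le
      _ ≤ _ := by linarith
  · intro t
    have hmc : Continuous fun t => f t / (K + C₁) + b * k t :=
      (hfc.div_const _).add (continuous_const.mul hkd.continuous)
    rw [timeOp_eq_convolution hα hmc (C := F / C₁)
      (fun s => by rw [abs_of_nonneg (hm0 s)]; exact hmF s)]
    have hconv : convolution (fun t => f t / (K + C₁) + b * k t) (mlKernelPos α κ)
        (ContinuousLinearMap.mul ℝ ℝ) volume t = k t / (K + C₁) := by
      have h3 := convolution_convolution_mlKernelPos hα hq0 hκ0 hκq.ne hfc hc t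
      rw [← hk] at h3
      have i1 : Integrable fun s => f s * mlKernelPos α κ (t - s) :=
        hc.convolutionExists_left (ContinuousLinearMap.mul ℝ ℝ) hfc iκ.locallyIntegrable t
      have i2 : Integrable fun s => k s * mlKernelPos α κ (t - s) := by
        refine Integrable.bdd_mul (iκ.comp_sub_left t) hkd.continuous.aestronglyMeasurable
          (c := F / q) (Filter.Eventually.of_forall fun s => ?_)
        rw [Real.norm_of_nonneg (hk0 s)]
        exact hkF s
      simp only [convolution_def, ContinuousLinearMap.mul_apply'] at h3 ⊢
      have e : ∀ s, (f s / (K + C₁) + b * k s) * mlKernelPos α κ (t - s) =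
          (1 / (K + C₁)) * (f s * mlKernelPos α κ (t - s)) +
            b * (k s * mlKernelPos α κ (t - s)) := fun s => by ring
      simp_rw [e]
      rw [integral_add (i1.const_mul _) (i2.const_mul _), integral_const_mul, integral_const_mul,
        h3]
      -- This choice of b makes the term f * K_κ cancel, leaving only k.
      have e2 : b / (q - κ) = -(1 / (K + C₁)) := by
        have : q - κ = -(κ * K / (K + C₁)) := by rw [hq]; field_simp; ring
        rw [this, hb]
        field_simp
      rw [mul_div_assoc', mul_div_right_comm, e2]
      ring
    rw [hconv, hcα, hb]
    have : (1 - α) / α = 1 / κ := by rw [hκ]; field_simp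
    rw [this]
    field_simp
    ring

/-! ### The extremal operator and the space barrier. -/

/-- The slope function of the maximal extremal operator. -/
noncomputable def extremalSlope (lam Lam a : ℝ) : ℝ := Lam * max a 0 - lam * max (-a) 0

theorem extremalSlope_mul (lam Lam : ℝ) {c : ℝ} (hc : 0 ≤ c) (a : ℝ) :
    extremalSlope lam Lam (c * a) = c * extremalSlope lam Lam a := by
  have h1 : max (c * a) 0 = c * max a 0 := by rw [mul_max_of_nonneg _ _ hc, mul_zero]
  have h2 : max (-(c * a)) 0 = c * max (-a) 0 := by
    rw [mul_max_of_nonneg _ _ hc, mul_zero, mul_neg]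
  rw [extremalSlope, h1, h2, extremalSlope]
  ring

theorem continuous_extremalSlope (lam Lam : ℝ) : Continuous (extremalSlope lam Lam) := by
  unfold extremalSlope
  fun_prop

/-- The slope function is increasing with slope at least `lam`. -/
theorem extremalSlope_le_sub {lam Lam a b d : ℝ} (hlam : 0 < lam) (hLam : lam ≤ Lam) (hd : 0 ≤ d)
    (hab : a ≤ b - d) : extremalSlope lam Lam a ≤ extremalSlope lam Lam b - lam * d := by
  unfold extremalSlope
  rcases le_total a 0 with ha | ha <;> rcases le_total b 0 with hb | hb <;>
    simp [ha, hb] <;> nlinarith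

theorem abs_extremalSlope_le {lam Lam : ℝ} (hlam : 0 < lam) (hLam : lam ≤ Lam) (a : ℝ) :
    |extremalSlope lam Lam a| ≤ Lam * |a| := by
  unfold extremalSlope
  rcases le_total a 0 with ha | ha
  · rw [max_eq_right ha, max_eq_left (by linarith), abs_of_nonpos ha, abs_le]
    constructor <;> nlinarith
  · rw [max_eq_left ha, max_eq_right (by linarith), abs_of_nonneg ha, abs_le]
    constructor <;> nlinarith

section Space

variable {n : ℕ}

/-- The maximal extremal operator acting on functions of space only. -/
noncomputable def spaceOp (lam Lam σ : ℝ) (g : EuclideanSpace ℝ (Fin n) → ℝ)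
    (x : EuclideanSpace ℝ (Fin n)) : ℝ :=
  ∫ h : EuclideanSpace ℝ (Fin n),
    extremalSlope lam Lam (g (x + h) + g (x - h) - 2 * g x) * ‖h‖ ^ (-(n : ℝ) - σ)

/-- In polar coordinates the integrand is y^(1-σ) on (0, 1] and y^(-1-σ) beyond; this is where 0 < σ
< 2 enters. -/
theorem integrable_min_sq_mul_rpow (hn : 1 ≤ n) {σ : ℝ} (hσ : σ ∈ Ioo (0 : ℝ) 2) :
    Integrable fun h : EuclideanSpace ℝ (Fin n) => min (‖h‖ ^ 2) 1 * ‖h‖ ^ (-(n : ℝ) - σ) := by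
  have : Nonempty (Fin n) := ⟨⟨0, hn⟩⟩
  refine (integrable_fun_norm_addHaar volume
    (f := fun y : ℝ => min (y ^ 2) 1 * y ^ (-(n : ℝ) - σ))).2 ?_
  rw [finrank_euclideanSpace, Fintype.card_fin]
  have hpow : ∀ y : ℝ, 0 < y → y ^ (n - 1) = y ^ ((n : ℝ) - 1) := fun y hy => by
    rw [← Real.rpow_natCast, Nat.cast_sub hn, Nat.cast_one]
  rw [← Ioc_union_Ioi_eq_Ioi (zero_le_one' ℝ)]
  refine IntegrableOn.union ?_ ?_
  · have h1 : IntegrableOn (fun y : ℝ => y ^ (1 - σ)) (Ioc 0 1) :=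
      (intervalIntegral.intervalIntegrable_rpow' (a := 0) (b := 1) (by linarith [hσ.2])).1
    refine h1.congr_fun (fun y hy => ?_) measurableSet_Ioc
    have h2 : min (y ^ 2) 1 = y ^ 2 := min_eq_left (pow_le_one₀ hy.1.le hy.2)
    simp only [smul_eq_mul]
    rw [h2, hpow y hy.1, ← Real.rpow_natCast y 2, ← Real.rpow_add hy.1, ← Real.rpow_add hy.1]
    congr 1
    push_cast
    ring
  · have h1 : IntegrableOn (fun y : ℝ => y ^ (-1 - σ)) (Ioi 1) :=
      integrableOn_Ioi_rpow_of_lt (by linarith [hσ.1]) one_pos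
    refine h1.congr_fun (fun y hy => ?_) measurableSet_Ioi
    have hy0 : 0 < y := one_pos.trans hy
    have h2 : min (y ^ 2) 1 = 1 := min_eq_right (one_le_pow₀ (le_of_lt hy))
    simp only [smul_eq_mul]
    rw [h2, one_mul, hpow y hy0, ← Real.rpow_add hy0]
    congr 1
    ring

theorem norm_extremalSlope_mul_le {lam Lam σ D a : ℝ} (hlam : 0 < lam) (hLam : lam ≤ Lam)
    {h : EuclideanSpace ℝ (Fin n)} (ha : |a| ≤ D * min (‖h‖ ^ 2) 1) :
    ‖extremalSlope lam Lam a * ‖h‖ ^ (-(n : ℝ) - σ)‖ ≤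
      Lam * D * (min (‖h‖ ^ 2) 1 * ‖h‖ ^ (-(n : ℝ) - σ)) := by
  rw [norm_mul, Real.norm_of_nonneg (Real.rpow_nonneg (norm_nonneg h) _), Real.norm_eq_abs,
    ← mul_assoc]
  refine mul_le_mul_of_nonneg_right ?_ (by positivity)
  calc |extremalSlope lam Lam a| ≤ Lam * |a| := abs_extremalSlope_le hlam hLam a
    _ ≤ Lam * (D * min (‖h‖ ^ 2) 1) := by
        have : 0 ≤ Lam := by linarith
        gcongr
    _ = _ := by ring

theorem integrable_extremal {lam Lam σ D : ℝ} (hn : 1 ≤ n) (hlam : 0 < lam) (hLam : lam ≤ Lam)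
    (hσ : σ ∈ Ioo (0 : ℝ) 2) {δ : EuclideanSpace ℝ (Fin n) → ℝ} (hm : Measurable δ)
    (hδ : ∀ h, |δ h| ≤ D * min (‖h‖ ^ 2) 1) :
    Integrable fun h : EuclideanSpace ℝ (Fin n) =>
      extremalSlope lam Lam (δ h) * ‖h‖ ^ (-(n : ℝ) - σ) := by
  refine ((integrable_min_sq_mul_rpow hn hσ).const_mul (Lam * D)).mono' ?_
    (Filter.Eventually.of_forall fun h => norm_extremalSlope_mul_le hlam hLam (hδ h))
  exact (((continuous_extremalSlope lam Lam).measurable.comp hm).mul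
    (measurable_norm.pow_const _)).aestronglyMeasurable

/-- For small h the gradient is Lipschitz, and the mean value inequality is applied to s ↦ η(x + sh)
+ η(x - sh) on [0, 1]; for large h boundedness of η suffices. -/
theorem exists_secondDiff_bound {η : EuclideanSpace ℝ (Fin n) → ℝ}
    (hη : ContDiff ℝ ((⊤ : ℕ∞) : WithTop ℕ∞) η) (hc : HasCompactSupport η)
    (h01 : ∀ x, η x ∈ Icc (0 : ℝ) 1) :
    ∃ D > 0, ∀ x h, |η (x + h) + η (x - h) - 2 * η x| ≤ D * min (‖h‖ ^ 2) 1 := by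
  have hd : ContDiff ℝ ((⊤ : ℕ∞) : WithTop ℕ∞) (fderiv ℝ η) := hη.fderiv_right (by simp)
  obtain ⟨L, hL⟩ := hd.lipschitzWith_of_hasCompactSupport (hc.fderiv (𝕜 := ℝ)) (by simp)
  have hdiff : Differentiable ℝ η := hη.differentiable (by simp)
  refine ⟨2 * L + 4, by positivity, fun x h => ?_⟩
  have h1 : |η (x + h) + η (x - h) - 2 * η x| ≤ 4 := by
    have a := h01 (x + h)
    have b := h01 (x - h)
    have c := h01 x
    rw [abs_le]
    constructor <;> linarith [a.1, a.2, b.1, b.2, c.1, c.2]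
  have h2 : |η (x + h) + η (x - h) - 2 * η x| ≤ 2 * L * ‖h‖ ^ 2 := by
    have hder : ∀ s : ℝ, HasDerivAt (fun s : ℝ => η (x + s • h) + η (x - s • h))
        (fderiv ℝ η (x + s • h) h - fderiv ℝ η (x - s • h) h) s := fun s => by
      have e1 : HasDerivAt (fun s : ℝ => x + s • h) h s := by
        simpa using ((hasDerivAt_id s).smul_const h).const_add x
      have e2 : HasDerivAt (fun s : ℝ => x - s • h) (-h) s := by
        simpa using ((hasDerivAt_id s).smul_const h).const_sub x
      have f1 := (hdiff (x + s • h)).hasFDerivAt.comp_hasDerivAt s e1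
      have f2 := (hdiff (x - s • h)).hasFDerivAt.comp_hasDerivAt s e2
      have := f1.add f2
      rw [map_neg, ← sub_eq_add_neg] at this
      exact this
    have hb := norm_image_sub_le_of_norm_deriv_le_segment_01'
      (f := fun s : ℝ => η (x + s • h) + η (x - s • h)) (C := 2 * L * ‖h‖ ^ 2)
      (fun s _ => (hder s).hasDerivWithinAt) fun s hs => by
        rw [← sub_apply]
        calc _ ≤ ‖fderiv ℝ η (x + s • h) - fderiv ℝ η (x - s • h)‖ * ‖h‖ :=
              ContinuousLinearMap.le_opNorm _ _
          _ ≤ (L * ‖(x + s • h) - (x - s • h)‖) * ‖h‖ := by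
              gcongr
              exact hL.norm_sub_le _ _
          _ ≤ (L * (2 * ‖h‖)) * ‖h‖ := by
              gcongr
              have : (x + s • h) - (x - s • h) = (2 * s) • h := by
                rw [mul_smul, two_smul]; abel
              rw [this, norm_smul, Real.norm_of_nonneg (by linarith [hs.1])]
              gcongr
              linarith [hs.2]
          _ = _ := by ring
    simp only [one_smul, zero_smul, add_zero, sub_zero, Real.norm_eq_abs] at hb
    convert! hb using 2
    ring
  rcases le_total (‖h‖ ^ 2) 1 with hh | hh
  · rw [min_eq_left hh]
    nlinarith [sq_nonneg ‖h‖]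
  · rw [min_eq_right hh]
    have : (0 : ℝ) ≤ L := L.2
    linarith

theorem continuous_spaceOp {lam Lam σ D : ℝ} (hn : 1 ≤ n) (hlam : 0 < lam) (hLam : lam ≤ Lam)
    (hσ : σ ∈ Ioo (0 : ℝ) 2) {g : EuclideanSpace ℝ (Fin n) → ℝ} (hg : Continuous g)
    (hD : ∀ x h, |g (x + h) + g (x - h) - 2 * g x| ≤ D * min (‖h‖ ^ 2) 1) :
    Continuous (spaceOp lam Lam σ g) := by
  refine continuous_of_dominated (bound := fun h : EuclideanSpace ℝ (Fin n) =>
    Lam * D * (min (‖h‖ ^ 2) 1 * ‖h‖ ^ (-(n : ℝ) - σ))) (fun x => ?_) (fun x => ?_)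
    ((integrable_min_sq_mul_rpow hn hσ).const_mul _) ?_
  · exact (integrable_extremal hn hlam hLam hσ
      (Continuous.measurable (by fun_prop)) (hD x)).aestronglyMeasurable
  · exact Filter.Eventually.of_forall fun h => norm_extremalSlope_mul_le hlam hLam (hD x h)
  · refine Filter.Eventually.of_forall fun h => ?_
    exact ((continuous_extremalSlope lam Lam).comp (by fun_prop)).mul continuous_const

/-- At a zero of η the function -η is maximal, so only the negative parts of its second differences
contribute, and they are not all zero. -/
theorem spaceOp_neg_lt_zero {lam Lam σ : ℝ} (hn : 1 ≤ n) (hlam : 0 < lam) (hLam : lam ≤ Lam)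
    (hσ : σ ∈ Ioo (0 : ℝ) 2) {η : EuclideanSpace ℝ (Fin n) → ℝ} (hη : Continuous η) {D : ℝ}
    (h0 : ∀ x, 0 ≤ η x)
    (hD : ∀ x h, |η (x + h) + η (x - h) - 2 * η x| ≤ D * min (‖h‖ ^ 2) 1)
    {x y : EuclideanSpace ℝ (Fin n)} (hx : η x = 0) (hy : 0 < η y) :
    spaceOp lam Lam σ (fun z => -η z) x < 0 := by
  set G : EuclideanSpace ℝ (Fin n) → ℝ := fun h =>
    lam * (η (x + h) + η (x - h)) * ‖h‖ ^ (-(n : ℝ) - σ) with hG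
  have e : ∀ h : EuclideanSpace ℝ (Fin n), extremalSlope lam Lam
      (-η (x + h) + -η (x - h) - 2 * -η x) * ‖h‖ ^ (-(n : ℝ) - σ) = -G h := fun h => by
    have h1 := h0 (x + h)
    have h2 := h0 (x - h)
    rw [hx, extremalSlope, max_eq_right (by linarith), max_eq_left (by linarith)]
    simp only [hG]
    ring
  have hG0 : 0 ≤ G := fun h => by
    have h1 := h0 (x + h)
    have h2 := h0 (x - h)
    simp only [hG, Pi.zero_apply]
    positivity
  have hint : Integrable G := by
    have := integrable_extremal (δ := fun h => -η (x + h) + -η (x - h) - 2 * -η x) (D := D)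
      hn hlam hLam hσ (Continuous.measurable (by fun_prop)) fun h => by
        have := hD x h
        rw [← abs_neg] at this
        convert! this using 2
        ring
    simp only [e] at this
    simpa using this.neg
  have hpos : 0 < ∫ h, G h := by
    rw [integral_pos_iff_support_of_nonneg hG0 hint]
    have hopen : IsOpen ({h : EuclideanSpace ℝ (Fin n) | 0 < η (x + h)} ∩ {0}ᶜ) :=
      (isOpen_lt continuous_const (by fun_prop)).inter isOpen_compl_singleton
    refine (hopen.measure_pos volume ⟨y - x, ?_, ?_⟩).trans_le (measure_mono ?_)
    · simpa using hy
    · simp only [mem_compl_iff, mem_singleton_iff, sub_eq_zero]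
      rintro rfl
      linarith
    · intro h hh
      have h1 : 0 < η (x + h) := hh.1
      have h2 := h0 (x - h)
      have h3 : 0 < ‖h‖ := norm_pos_iff.2 hh.2
      have : 0 < G h := by simp only [hG]; positivity
      exact this.ne'
  rw [spaceOp]
  simp_rw [e]
  rw [integral_neg]
  linarith

/-- A smooth cutoff `η` of the unit ball with `ℳ⁺(-η) ≤ C η` on the closure of its support. -/
theorem exists_space_barrier {lam Lam σ : ℝ} (hn : 1 ≤ n) (hlam : 0 < lam) (hLam : lam ≤ Lam)
    (hσ : σ ∈ Ioo (0 : ℝ) 2) :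
    ∃ η : EuclideanSpace ℝ (Fin n) → ℝ, ContDiff ℝ ((⊤ : ℕ∞) : WithTop ℕ∞) η ∧
      (∀ x, η x ∈ Icc (0 : ℝ) 1) ∧ (∀ x ∈ Metric.ball 0 1, η x = 1) ∧
      (∀ x, x ∉ Metric.closedBall 0 (3 / 2) → η x = 0) ∧
      (∃ D > 0, ∀ x h, |η (x + h) + η (x - h) - 2 * η x| ≤ D * min (‖h‖ ^ 2) 1) ∧
      ∃ C > 0, ∀ x ∈ Metric.closedBall 0 (3 / 2),
        spaceOp lam Lam σ (fun z => -η z) x ≤ C * η x := by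
  let η : ContDiffBump (0 : EuclideanSpace ℝ (Fin n)) :=
    { rIn := 1, rOut := 3 / 2, rIn_pos := one_pos, rIn_lt_rOut := by norm_num }
  have h01 : ∀ x, η x ∈ Icc (0 : ℝ) 1 := fun x => ⟨η.nonneg, η.le_one⟩
  have hone : ∀ x ∈ Metric.ball (0 : EuclideanSpace ℝ (Fin n)) 1, η x = 1 := fun x hx =>
    η.one_of_mem_closedBall (Metric.ball_subset_closedBall hx)
  have hcd : ContDiff ℝ ((⊤ : ℕ∞) : WithTop ℕ∞) η := η.contDiff
  obtain ⟨D, hD0, hD⟩ := exists_secondDiff_bound hcd η.hasCompactSupport h01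
  refine ⟨η, hcd, h01, hone, fun x hx => ?_, ⟨D, hD0, hD⟩, ?_⟩
  · refine η.zero_of_le_dist ?_
    simp only [Metric.mem_closedBall, not_le] at hx
    exact hx.le
  have hcont : Continuous (spaceOp lam Lam σ fun z => -η z) :=
    continuous_spaceOp (D := D) hn hlam hLam hσ (by fun_prop) fun x h => by
      have := hD x h
      rw [← abs_neg] at this
      convert! this using 2
      ring
  -- On this compact set η cannot vanish, by the strict negativity at zeros of η, so the quotient by
  -- η is bounded. Elsewhere the operator is negative and any C > 0 works.
  have hcpt : IsCompact (Metric.closedBall (0 : EuclideanSpace ℝ (Fin n)) (3 / 2) ∩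
      {x | 0 ≤ spaceOp lam Lam σ (fun z => -η z) x}) :=
    (isCompact_closedBall _ _).inter_right (isClosed_le continuous_const hcont)
  have hpos : ∀ x, 0 ≤ spaceOp lam Lam σ (fun z => -η z) x → 0 < η x := fun x hx => by
    by_contra! h
    have h0 : η x = 0 := le_antisymm h (h01 x).1
    have h1 : 0 < η 0 := by rw [hone 0 (by simp)]; exact one_pos
    exact absurd (spaceOp_neg_lt_zero hn hlam hLam hσ η.continuous (fun x => (h01 x).1) hD h0 h1)
      (not_lt.2 hx)
  have hquot : ContinuousOn (fun x => spaceOp lam Lam σ (fun z => -η z) x / η x)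
      (Metric.closedBall (0 : EuclideanSpace ℝ (Fin n)) (3 / 2) ∩
      {x | 0 ≤ spaceOp lam Lam σ (fun z => -η z) x}) :=
    hcont.continuousOn.div η.continuous.continuousOn fun x hx => (hpos x hx.2).ne'
  obtain ⟨C, hC⟩ := hcpt.bddAbove_image hquot
  refine ⟨max C 1, by positivity, fun x hx => ?_⟩
  rcases lt_or_ge (spaceOp lam Lam σ (fun z => -η z) x) 0 with h | h
  · have := (h01 x).1
    exact h.le.trans (by positivity)
  · have h1 := hC ⟨x, ⟨hx, h⟩, rfl⟩
    have h2 := hpos x h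
    rw [← div_le_iff₀ h2]
    exact h1.trans (le_max_left _ _)

end Space

/-! ### The pulse and the comparison at a touching point. -/

section Comparison

variable {n : ℕ}

/-- Smoothness of the pulse makes m, and hence the test function, smooth. The pulse is the space
integral of a smooth G ≤ 1 supported in U and equal to 1 on a compact subset of measure above μ/2.
-/
theorem exists_smooth_minorant {U : Set (EuclideanSpace ℝ (Fin n) × ℝ)} (hU : IsOpen U)
    (hUs : U ⊆ Metric.ball 0 1 ×ˢ Ioo (-2) (-1)) {μ : ℝ} (hμ : 0 < μ)
    (hμU : ENNReal.ofReal μ ≤ volume U) :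
    ∃ f : ℝ → ℝ, ContDiff ℝ ((⊤ : ℕ∞) : WithTop ℕ∞) f ∧ (∀ t, 0 ≤ f t) ∧
      (∀ t ∉ Ioo (-2 : ℝ) (-1), f t = 0) ∧
      (∀ t, f t ≤ volume.real {x | (x, t) ∈ U}) ∧ μ / 2 ≤ ∫ t, f t := by
  obtain ⟨K, hKU, hK, hKμ⟩ := hU.exists_lt_isCompact (μ := volume)
    (r := ENNReal.ofReal (μ / 2)) (lt_of_lt_of_le
      ((ENNReal.ofReal_lt_ofReal_iff hμ).2 (by linarith)) hμU)
  obtain ⟨G, hG, hGr, hGs, hGK⟩ := exists_contMDiff_support_eq_eq_one_iff (n := (⊤ : ℕ∞))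
    (modelWithCornersSelf ℝ (EuclideanSpace ℝ (Fin n) × ℝ)) hU hK.isClosed hKU
  rw [contMDiff_iff_contDiff] at hG
  have hG01 : ∀ p, G p ∈ Icc (0 : ℝ) 1 := fun p => hGr (mem_range_self p)
  have hG0 : ∀ p, p ∉ U → G p = 0 := fun p hp => by
    rw [← hGs] at hp
    simpa using hp
  have hGc : HasCompactSupport G := by
    refine HasCompactSupport.intro
      ((isCompact_closedBall (0 : EuclideanSpace ℝ (Fin n)) 1).prod (isCompact_Icc
        (a := (-2 : ℝ)) (b := -1))) fun p hp => hG0 p fun h => hp ?_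
    exact ⟨Metric.ball_subset_closedBall (hUs h).1, Ioo_subset_Icc_self (hUs h).2⟩
  have hGint : Integrable G := hG.continuous.integrable_of_hasCompactSupport hGc
  refine ⟨fun t => ∫ x, G (x, t), ?_, fun t => integral_nonneg fun x => (hG01 _).1, ?_, ?_, ?_⟩
  -- The space integral is the convolution of G(·, t) with the constant 1, evaluated at 0.
  · have h := contDiffOn_convolution_right_with_param (μ := volume) (n := (⊤ : ℕ∞))
      (ContinuousLinearMap.mul ℝ ℝ) (f := fun _ : EuclideanSpace ℝ (Fin n) => (1 : ℝ))
      (g := fun (t : ℝ) (x : EuclideanSpace ℝ (Fin n)) => G (x, t)) (s := univ)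
      (k := Metric.closedBall 0 1) isOpen_univ (isCompact_closedBall _ _)
      (fun t x _ hx => hG0 _ fun h => hx (Metric.ball_subset_closedBall (hUs h).1))
      (locallyIntegrable_const 1)
      (hG.comp (contDiff_snd.prodMk contDiff_fst)).contDiffOn
    rw [univ_prod_univ, contDiffOn_univ] at h
    have h2 := h.comp (contDiff_id.prodMk (contDiff_const (c := (0 : EuclideanSpace ℝ (Fin n)))))
    convert! h2 using 1
    funext t
    simp only [Function.comp, id, convolution_def, ContinuousLinearMap.mul_apply', one_mul]
    exact (integral_sub_left_eq_self (fun x => G (x, t)) volume 0).symm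
  · intro t ht
    have : ∀ x, G (x, t) = 0 := fun x => hG0 _ fun h => ht (hUs h).2
    simp [this]
  · intro t
    have hm : MeasurableSet {x | (x, t) ∈ U} :=
      (hU.preimage (by fun_prop : Continuous fun x : EuclideanSpace ℝ (Fin n) =>
        (x, t))).measurableSet
    have hsub : {x | (x, t) ∈ U} ⊆ Metric.ball 0 1 := fun x hx => (hUs hx).1
    have hfin : volume {x | (x, t) ∈ U} ≠ ⊤ :=
      ((measure_mono hsub).trans_lt measure_ball_lt_top).ne
    rw [← integral_indicator_one hm]
    refine integral_mono_of_nonneg (Filter.Eventually.of_forall fun x => (hG01 _).1)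
      ((integrable_indicator_iff hm).2 (integrableOn_const hfin))
      (Filter.Eventually.of_forall fun x => ?_)
    by_cases hx : (x, t) ∈ U
    · simpa [indicator, hx] using (hG01 (x, t)).2
    · simp [indicator, hx, hG0 _ hx]
  · rw [Measure.volume_eq_prod] at hGint
    have hKfin : volume K ≠ ⊤ := hK.measure_lt_top.ne
    calc μ / 2 ≤ volume.real K := by
          rw [Measure.real, ← ENNReal.ofReal_le_iff_le_toReal hKfin]
          exact hKμ.le
      _ = ∫ p, K.indicator 1 p := (integral_indicator_one hK.measurableSet).symm
      _ ≤ ∫ p, G p := by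
          refine integral_mono_of_nonneg
            (Filter.Eventually.of_forall fun p => indicator_nonneg (fun _ _ => zero_le_one) p)
            hGint (Filter.Eventually.of_forall fun p => ?_)
          by_cases hp : p ∈ K
          · simp [indicator, hp, (hGK p).1 hp]
          · simpa [indicator, hp] using (hG01 p).1
      _ = ∫ t, ∫ x, G (x, t) := by
          rw [Measure.volume_eq_prod, integral_prod_symm _ hGint]

/-- Second differences of v at x₀ are at most those of -mη, and smaller by 1/2 when x₀ + h ∈ S lies
outside the ball. There ‖h‖ ≤ 3/2 + 1, which bounds the kernel below. -/
theorem spaceOp_le_of_touching {lam Lam σ : ℝ} (hn : 1 ≤ n) (hlam : 0 < lam) (hLam : lam ≤ Lam)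
    (hσ : σ ∈ Ioo (0 : ℝ) 2) {g v η : EuclideanSpace ℝ (Fin n) → ℝ} (hg : Measurable g)
    {C : ℝ} (hgC : ∀ x, |g x| ≤ C) (hη : Continuous η) (h01 : ∀ x, η x ∈ Icc (0 : ℝ) 1) {D : ℝ}
    (hD0 : 0 < D) (hD : ∀ x h, |η (x + h) + η (x - h) - 2 * η x| ≤ D * min (‖h‖ ^ 2) 1)
    {W m ε : ℝ} (hm : 0 ≤ m) (hε : 0 < ε) (hε1 : ε ≤ 1) {x₀ : EuclideanSpace ℝ (Fin n)}
    (hx₀ : ‖x₀‖ ≤ 3 / 2) (hle : ∀ x, g x ≤ W - m * η x) {S : Set (EuclideanSpace ℝ (Fin n))}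
    (hS : MeasurableSet S) (hS1 : S ⊆ Metric.ball 0 1)
    (hgap : ∀ x ∈ S, g x ≤ W - m * η x - 1 / 2)
    (hv1 : ∀ x ∈ Metric.ball x₀ ε, v x = W - m * η x) (hv2 : ∀ x ∉ Metric.ball x₀ ε, v x = g x) :
    spaceOp lam Lam σ v x₀ ≤ m * spaceOp lam Lam σ (fun z => -η z) x₀ -
      lam * (1 / 2) * (5 / 2) ^ (-(n : ℝ) - σ) * volume.real (S \ Metric.ball x₀ ε) := by
  classical
  have hvm : Measurable v := by
    have : v = fun x => if x ∈ Metric.ball x₀ ε then W - m * η x else g x := by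
      funext x
      split_ifs with h
      · exact hv1 x h
      · exact hv2 x h
    rw [this]
    exact Measurable.ite measurableSet_ball (Continuous.measurable (by fun_prop)) hg
  have hC0 : 0 ≤ C := (abs_nonneg _).trans (hgC 0)
  set C' : ℝ := max C (|W| + m) with hC'
  have hvC : ∀ x, |v x| ≤ C' := fun x => by
    by_cases h : x ∈ Metric.ball x₀ ε
    · rw [hv1 x h]
      refine le_trans ?_ (le_max_right _ _)
      have := h01 x
      calc |W - m * η x| ≤ |W| + |m * η x| := abs_sub _ _
        _ ≤ |W| + m := by
            rw [abs_of_nonneg (mul_nonneg hm this.1)]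
            nlinarith [this.2]
    · rw [hv2 x h]
      exact (hgC x).trans (le_max_left _ _)
  have hC'0 : 0 ≤ C' := hC0.trans (le_max_left _ _)
  have hv0 : v x₀ = W - m * η x₀ := hv1 x₀ (Metric.mem_ball_self hε)
  have hvle : ∀ x, v x ≤ W - m * η x := fun x => by
    by_cases h : x ∈ Metric.ball x₀ ε
    · exact (hv1 x h).le
    · rw [hv2 x h]; exact hle x
  -- Inside the ball v is smooth, and outside ‖h‖ ≥ ε turns boundedness into a multiple of min(‖h‖²,
  -- 1); this makes the integral converge.
  have hδ : ∀ h, |v (x₀ + h) + v (x₀ - h) - 2 * v x₀| ≤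
      (m * D + 4 * C' / ε ^ 2) * min (‖h‖ ^ 2) 1 := fun h => by
    have hmin : 0 ≤ min (‖h‖ ^ 2) 1 := le_min (by positivity) zero_le_one
    have hq : 0 ≤ 4 * C' / ε ^ 2 := by positivity
    by_cases hh : ‖h‖ < ε
    · rw [hv0, hv1 _ (by simpa [Metric.mem_ball, dist_eq_norm] using hh),
        hv1 _ (by simpa [Metric.mem_ball, dist_eq_norm] using hh)]
      have e : W - m * η (x₀ + h) + (W - m * η (x₀ - h)) - 2 * (W - m * η x₀) =
          -(m * (η (x₀ + h) + η (x₀ - h) - 2 * η x₀)) := by ring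
      rw [e, abs_neg, abs_mul, abs_of_nonneg hm]
      calc m * |η (x₀ + h) + η (x₀ - h) - 2 * η x₀| ≤ m * (D * min (‖h‖ ^ 2) 1) := by
            gcongr
            exact hD x₀ h
        _ ≤ _ := by nlinarith [mul_nonneg hq hmin]
    · have hεh : ε ^ 2 ≤ min (‖h‖ ^ 2) 1 :=
        le_min (pow_le_pow_left₀ hε.le (not_lt.1 hh) 2) (pow_le_one₀ hε.le hε1)
      have h1 := abs_le.1 (hvC (x₀ + h))
      have h2 := abs_le.1 (hvC (x₀ - h))
      have h3 := abs_le.1 (hvC x₀)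
      have h4 : |v (x₀ + h) + v (x₀ - h) - 2 * v x₀| ≤ 4 * C' := by
        rw [abs_le]
        constructor <;> linarith [h1.1, h1.2, h2.1, h2.2, h3.1, h3.2]
      have h5 : 4 * C' ≤ 4 * C' / ε ^ 2 * min (‖h‖ ^ 2) 1 := by
        calc 4 * C' = 4 * C' / ε ^ 2 * ε ^ 2 := by field_simp
          _ ≤ _ := by gcongr
      have h6 : 0 ≤ m * D * min (‖h‖ ^ 2) 1 := by positivity
      linarith
  have hiv := integrable_extremal hn hlam hLam hσ
    (δ := fun h => v (x₀ + h) + v (x₀ - h) - 2 * v x₀) (by fun_prop) hδ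
  have hiη := integrable_extremal (lam := lam) (Lam := Lam) (σ := σ) (D := D)
    (δ := fun h => -η (x₀ + h) + -η (x₀ - h) - 2 * -η x₀) hn hlam hLam hσ
    (Continuous.measurable (by fun_prop)) fun h => by
      have := hD x₀ h
      rw [← abs_neg] at this
      convert! this using 2
      ring
  set T := S \ Metric.ball x₀ ε with hT
  have hTm : MeasurableSet T := hS.diff measurableSet_ball
  have hTfin : volume T ≠ ⊤ := ((measure_mono (sdiff_subset.trans hS1)).trans_lt
    (measure_ball_lt_top (x := (0 : EuclideanSpace ℝ (Fin n))) (r := 1))).ne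
  have hiT : Integrable (T.indicator (1 : EuclideanSpace ℝ (Fin n) → ℝ)) :=
    (integrable_indicator_iff hTm).2 (integrableOn_const hTfin)
  set c := lam * (1 / 2) * (5 / 2 : ℝ) ^ (-(n : ℝ) - σ) with hc
  have hc0 : 0 < c := by positivity
  have hpt : ∀ h : EuclideanSpace ℝ (Fin n),
      extremalSlope lam Lam (v (x₀ + h) + v (x₀ - h) - 2 * v x₀) * ‖h‖ ^ (-(n : ℝ) - σ) ≤
      m * (extremalSlope lam Lam (-η (x₀ + h) + -η (x₀ - h) - 2 * -η x₀) *
        ‖h‖ ^ (-(n : ℝ) - σ)) - c * T.indicator 1 (x₀ + h) := fun h => by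
    have hk0 : 0 ≤ ‖h‖ ^ (-(n : ℝ) - σ) := Real.rpow_nonneg (norm_nonneg h) _
    rw [← mul_assoc, ← extremalSlope_mul lam Lam hm]
    by_cases hh : x₀ + h ∈ T
    · rw [indicator_of_mem hh, Pi.one_apply, mul_one]
      have h1 : v (x₀ + h) ≤ W - m * η (x₀ + h) - 1 / 2 := by
        rw [hv2 _ hh.2]
        exact hgap _ hh.1
      have h2 := extremalSlope_le_sub hlam hLam (d := 1 / 2) (by norm_num)
        (a := v (x₀ + h) + v (x₀ - h) - 2 * v x₀)
        (b := m * (-η (x₀ + h) + -η (x₀ - h) - 2 * -η x₀)) (by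
          rw [hv0]; linarith [hvle (x₀ - h)])
      have hhε : ε ≤ ‖h‖ := by
        have := hh.2
        simpa [Metric.mem_ball, dist_eq_norm] using this
      have h3 : ‖h‖ ≤ 5 / 2 := by
        have h4 : ‖x₀ + h‖ < 1 := by simpa using hS1 hh.1
        have : h = (x₀ + h) - x₀ := by abel
        rw [this]
        exact (norm_sub_le _ _).trans (by linarith)
      have h5 : (5 / 2 : ℝ) ^ (-(n : ℝ) - σ) ≤ ‖h‖ ^ (-(n : ℝ) - σ) :=
        Real.rpow_le_rpow_of_nonpos (hε.trans_le hhε) h3 (by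
          have := hσ.1
          have : (0 : ℝ) ≤ n := n.cast_nonneg
          linarith)
      have h6 := mul_le_mul_of_nonneg_right h2 hk0
      have h7 : c ≤ lam * (1 / 2) * ‖h‖ ^ (-(n : ℝ) - σ) := by
        rw [hc]; gcongr
      linarith
    · rw [indicator_of_notMem hh, mul_zero, sub_zero]
      have h2 := extremalSlope_le_sub hlam hLam (d := 0) le_rfl
        (a := v (x₀ + h) + v (x₀ - h) - 2 * v x₀)
        (b := m * (-η (x₀ + h) + -η (x₀ - h) - 2 * -η x₀)) (by
          rw [hv0]; linarith [hvle (x₀ - h), hvle (x₀ + h)])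
      rw [mul_zero, sub_zero] at h2
      exact mul_le_mul_of_nonneg_right h2 hk0
  calc spaceOp lam Lam σ v x₀
      ≤ ∫ h : EuclideanSpace ℝ (Fin n),
        (m * (extremalSlope lam Lam (-η (x₀ + h) + -η (x₀ - h) - 2 * -η x₀) *
        ‖h‖ ^ (-(n : ℝ) - σ)) - c * T.indicator 1 (x₀ + h)) :=
        integral_mono hiv ((hiη.const_mul m).sub ((hiT.comp_add_left x₀).const_mul c)) hpt
    _ = _ := by
        rw [integral_sub (hiη.const_mul m) ((hiT.comp_add_left x₀).const_mul c),
          integral_const_mul, integral_const_mul,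
          integral_add_left_eq_self (T.indicator (1 : EuclideanSpace ℝ (Fin n) → ℝ)) x₀,
          integral_indicator_one hTm]
        rfl

end Comparison

/-- With equal values at t and a smaller past, every increment is larger, and the kernel is
positive. -/
theorem timeOp_le_of_touching {α : ℝ} (hα : α ∈ Ioo (0 : ℝ) 1) {V φ : ℝ → ℝ} {t C C' : ℝ}
    (hV : AEStronglyMeasurable V (volume.restrict (Iio t))) (hVC : ∀ s < t, |V s| ≤ C)
    (hφ : Continuous φ) (hφC : ∀ s < t, |φ s| ≤ C') (heq : V t = φ t) (hle : ∀ s < t, V s ≤ φ s) :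
    timeOp α φ t ≤ timeOp α V t := by
  have hκ : 0 < α / (1 - α) := div_pos hα.1 (by linarith [hα.2])
  refine mul_le_mul_of_nonneg_left ?_ (abConst_pos hα).le
  simp only [abKernel_eq_mlKernel]
  refine setIntegral_mono_on ?_ ?_ measurableSet_Iio fun s hs => ?_
  · refine integrableOn_Iio_mul_mlKernel hα hκ (C := |φ t| + C')
      (Continuous.aestronglyMeasurable (by fun_prop)) fun s hs => ?_
    exact (abs_sub _ _).trans (by linarith [hφC s hs])
  · refine integrableOn_Iio_mul_mlKernel hα hκ (C := |V t| + C)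
      (aestronglyMeasurable_const.sub hV) fun s hs => ?_
    exact (abs_sub _ _).trans (by linarith [hVC s hs])
  · have hs' : s < t := hs
    refine mul_le_mul_of_nonneg_right ?_ (mlKernel_pos hα hκ.le (sub_pos.2 hs')).le
    linarith [hle s hs']

theorem timeOp_barrier {α : ℝ} (hα : α ∈ Ioo (0 : ℝ) 1) {m : ℝ → ℝ} (hm : Continuous m) {C : ℝ}
    (hC : ∀ s, |m s| ≤ C) (W e δ t : ℝ) :
    timeOp α (fun s => W - m s * e + δ * Real.exp s) t =
      -(e * timeOp α m t) + abNorm α * (δ * Real.exp t) := by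
  have hκ : 0 < α / (1 - α) := div_pos hα.1 (by linarith [hα.2])
  rw [← timeOp_exp hα]
  simp only [timeOp, abKernel_eq_mlKernel]
  have i1 : IntegrableOn (fun s => (m t - m s) * mlKernel α (α / (1 - α)) (t - s)) (Iio t) :=
    integrableOn_Iio_mul_mlKernel hα hκ (C := C + C)
      (Continuous.aestronglyMeasurable (by fun_prop)) fun s _ =>
        (abs_sub _ _).trans (by linarith [hC s, hC t])
  have i2 : IntegrableOn (fun s => (δ * Real.exp t - δ * Real.exp s) *
      mlKernel α (α / (1 - α)) (t - s)) (Iio t) := by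
    refine integrableOn_Iio_mul_mlKernel hα hκ (C := |δ| * Real.exp t)
      (Continuous.aestronglyMeasurable (by fun_prop)) fun s hs => ?_
    rw [← mul_sub, abs_mul]
    have h1 := Real.exp_le_exp.2 hs.le
    have h2 := Real.exp_pos s
    rw [abs_of_nonneg (sub_nonneg.2 h1)]
    gcongr
    linarith
  have e1 : ∀ s, (W - m t * e + δ * Real.exp t - (W - m s * e + δ * Real.exp s)) *
      mlKernel α (α / (1 - α)) (t - s) =
      -e * ((m t - m s) * mlKernel α (α / (1 - α)) (t - s)) +
        (δ * Real.exp t - δ * Real.exp s) * mlKernel α (α / (1 - α)) (t - s) := fun s => by ring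
  simp_rw [e1]
  rw [integral_add (i1.const_mul (-e)) i2, integral_const_mul]
  ring

/-! ### Measurability, application to the test function, and conclusion. -/

section Main

variable {n : ℕ}

theorem volume_real_ball_le (hn : 1 ≤ n) {ε : ℝ} (hε : 0 < ε) (hε1 : ε ≤ 1)
    (x : EuclideanSpace ℝ (Fin n)) :
    volume.real (Metric.ball x ε) ≤
      ε * volume.real (Metric.ball (0 : EuclideanSpace ℝ (Fin n)) 1) := by
  rw [Measure.real, Measure.addHaar_ball_of_pos _ _ hε, ENNReal.toReal_mul,
    ENNReal.toReal_ofReal (by positivity), finrank_euclideanSpace, Fintype.card_fin]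
  refine mul_le_mul_of_nonneg_right ?_ ENNReal.toReal_nonneg
  exact pow_le_of_le_one hε.le hε1 (by omega)

/-- The set where `u < 1/4` inside the cylinder is open and as large as the set where `u ≤ 0`. -/
theorem isOpen_sublevel_and_volume {u : EuclideanSpace ℝ (Fin n) × ℝ → ℝ}
    (hu : UpperSemicontinuousOn u (univ ×ˢ Iic 0)) :
    IsOpen ({p | u p < 1 / 4} ∩ Metric.ball 0 1 ×ˢ Ioo (-2) (-1)) ∧
    volume ({p | u p ≤ 0} ∩ (Metric.ball 0 1 ×ˢ Icc (-2) (-1))) ≤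
      volume ({p | u p < 1 / 4} ∩ Metric.ball 0 1 ×ˢ Ioo (-2) (-1)) := by
  constructor
  · rw [isOpen_iff_mem_nhds]
    intro p hp
    have hO : (Metric.ball (0 : EuclideanSpace ℝ (Fin n)) 1 ×ˢ Ioo (-2 : ℝ) (-1)) ∈ nhds p :=
      (Metric.isOpen_ball.prod isOpen_Ioo).mem_nhds hp.2
    have hN : (univ : Set (EuclideanSpace ℝ (Fin n))) ×ˢ Iic (0 : ℝ) ∈ nhds p :=
      Filter.mem_of_superset hO fun q hq => ⟨mem_univ _, by
        have := hq.2.2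
        simp only [mem_Iic]
        linarith⟩
    have h1 := hu p (mem_of_mem_nhds hN) (1 / 4) hp.1
    rw [nhdsWithin_eq_nhds.2 hN] at h1
    exact Filter.inter_mem h1 hO
  · have hnull : volume ((univ : Set (EuclideanSpace ℝ (Fin n))) ×ˢ ({-2, -1} : Set ℝ)) = 0 := by
      rw [Measure.volume_eq_prod, Measure.prod_prod,
        (Set.toFinite ({-2, -1} : Set ℝ)).measure_zero, mul_zero]
    refine (measure_mono (t := ({p | u p < 1 / 4} ∩ Metric.ball 0 1 ×ˢ Ioo (-2) (-1)) ∪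
      univ ×ˢ ({-2, -1} : Set ℝ)) ?_).trans ((measure_union_le _ _).trans (by rw [hnull, add_zero]))
    rintro ⟨x, t⟩ ⟨h1, h2, h3, h4⟩
    simp only at h3 h4
    rcases h3.eq_or_lt with h | h
    · exact Or.inr ⟨mem_univ _, by simp [← h]⟩
    rcases h4.eq_or_lt with h' | h'
    · exact Or.inr ⟨mem_univ _, by simp [h']⟩
    refine Or.inl ⟨?_, h2, h, h'⟩
    have : u (x, t) ≤ 0 := h1
    simp only [mem_ofPred_eq]
    linarith

theorem measurable_slice_space {u : EuclideanSpace ℝ (Fin n) × ℝ → ℝ}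
    (hu : UpperSemicontinuousOn u (univ ×ˢ Iic 0)) {t : ℝ} (ht : t ≤ 0) :
    Measurable fun x => u (x, t) := by
  refine UpperSemicontinuous.measurable ?_
  rw [← upperSemicontinuousOn_univ_iff]
  exact hu.comp (Continuous.continuousOn (by fun_prop))
    fun x _ => ⟨mem_univ _, ht⟩

theorem aestronglyMeasurable_slice_time {u : EuclideanSpace ℝ (Fin n) × ℝ → ℝ}
    (hu : UpperSemicontinuousOn u (univ ×ˢ Iic 0)) (x : EuclideanSpace ℝ (Fin n)) {t : ℝ}
    (ht : t ≤ 0) : AEStronglyMeasurable (fun s => u (x, s)) (volume.restrict (Iio t)) := by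
  -- Upper semicontinuity is known only up to time 0, so time is truncated there.
  have h : Measurable fun s : ℝ => u (x, min s 0) := by
    refine UpperSemicontinuous.measurable ?_
    rw [← upperSemicontinuousOn_univ_iff]
    exact hu.comp (Continuous.continuousOn (by fun_prop))
      fun s _ => ⟨mem_univ _, min_le_right s 0⟩
  refine h.aestronglyMeasurable.congr ?_
  filter_upwards [ae_restrict_mem measurableSet_Iio] with s hs
  rw [min_eq_left (le_of_lt (lt_of_lt_of_le hs ht))]

theorem le_timeDeriv_replaceOn {α : ℝ} (hα : α ∈ Ioo (0 : ℝ) 1)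
    {u : EuclideanSpace ℝ (Fin n) × ℝ → ℝ} (hu : UpperSemicontinuousOn u (univ ×ˢ Iic 0)) {C : ℝ}
    (hC : ∀ x, ∀ t ≤ 0, |u (x, t)| ≤ C) {m : ℝ → ℝ} (hm : Continuous m) {M : ℝ}
    (hM : ∀ s, |m s| ≤ M) {η : EuclideanSpace ℝ (Fin n) → ℝ} {W θ ε : ℝ}
    {p : EuclideanSpace ℝ (Fin n) × ℝ} (hp : p.2 ≤ 0) (hε : 0 < ε)
    (hle : ∀ s ≤ p.2, u (p.1, s) ≤ W - m s * η p.1 + θ * Real.exp s) :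
    abNorm α * (θ * Real.exp p.2) - η p.1 * timeOp α m p.2 ≤
      timeDeriv α (replaceOn (backCylinder ε p)
        (fun q => W - m q.2 * η q.1 + θ * Real.exp q.2) u) p := by
  classical
  obtain ⟨x₀, t₀⟩ := p
  simp only at hp hle ⊢
  set φ : ℝ → ℝ := fun s => W - m s * η x₀ + θ * Real.exp s with hφ
  have hφc : Continuous φ := by fun_prop
  have hφb : ∀ s < t₀, |φ s| ≤ |W| + M * |η x₀| + |θ| := fun s hs => by
    have h3 : Real.exp s ≤ 1 := Real.exp_le_one_iff.2 (hs.le.trans hp)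
    calc |φ s| ≤ |W - m s * η x₀| + |θ * Real.exp s| := abs_add_le _ _
      _ ≤ |W| + |m s * η x₀| + |θ * Real.exp s| := by gcongr; exact abs_sub _ _
      _ = |W| + |m s| * |η x₀| + |θ| * Real.exp s := by
          rw [abs_mul, abs_mul, abs_of_pos (Real.exp_pos s)]
      _ ≤ |W| + M * |η x₀| + |θ| * 1 := by gcongr; exact hM s
      _ = _ := by rw [mul_one]
  set v : ℝ → ℝ := fun s => replaceOn (backCylinder ε (x₀, t₀))
    (fun q => W - m q.2 * η q.1 + θ * Real.exp q.2) u (x₀, s) with hv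
  have hve : v = (Icc (t₀ - ε) t₀).piecewise φ fun s => u (x₀, s) := by
    funext s
    by_cases hs : s ∈ Icc (t₀ - ε) t₀
    · rw [piecewise_eq_of_mem _ _ _ hs]
      exact if_pos ⟨Metric.mem_ball_self hε, hs⟩
    · rw [piecewise_eq_of_notMem _ _ _ hs]
      exact if_neg fun h => hs h.2
  have hVm : AEStronglyMeasurable v (volume.restrict (Iio t₀)) := by
    rw [hve]
    exact AEStronglyMeasurable.piecewise measurableSet_Icc
      hφc.aestronglyMeasurable.restrict (aestronglyMeasurable_slice_time hu x₀ hp).restrict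
  have key := timeOp_le_of_touching hα (t := t₀) (C := max (|W| + M * |η x₀| + |θ|) C) hVm
    (fun s hs => by
      rw [hve]
      by_cases h : s ∈ Icc (t₀ - ε) t₀
      · rw [piecewise_eq_of_mem _ _ _ h]
        exact (hφb s hs).trans (le_max_left _ _)
      · rw [piecewise_eq_of_notMem _ _ _ h]
        exact (hC x₀ s (hs.le.trans hp)).trans (le_max_right _ _))
    hφc hφb (by rw [hve]; exact piecewise_eq_of_mem _ _ _ ⟨by linarith, le_rfl⟩) fun s hs => by
      rw [hve]
      by_cases h : s ∈ Icc (t₀ - ε) t₀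
      · exact (piecewise_eq_of_mem _ _ _ h).le
      · rw [piecewise_eq_of_notMem _ _ _ h]
        exact hle s hs.le
  rw [hφ, timeOp_barrier hα hm hM] at key
  have e : timeDeriv α (replaceOn (backCylinder ε (x₀, t₀))
    (fun q => W - m q.2 * η q.1 + θ * Real.exp q.2) u) (x₀, t₀) = timeOp α v t₀ := rfl
  rw [e]
  linarith

theorem extremalPlus_replaceOn_le {lam Lam σ : ℝ} (hn : 1 ≤ n) (hlam : 0 < lam)
    (hLam : lam ≤ Lam) (hσ : σ ∈ Ioo (0 : ℝ) 2) {u : EuclideanSpace ℝ (Fin n) × ℝ → ℝ}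
    {p : EuclideanSpace ℝ (Fin n) × ℝ} (hu : Measurable fun x => u (x, p.2)) {C : ℝ}
    (hC : ∀ x, |u (x, p.2)| ≤ C) {η : EuclideanSpace ℝ (Fin n) → ℝ} (hη : Continuous η)
    (h01 : ∀ x, η x ∈ Icc (0 : ℝ) 1) {D : ℝ} (hD0 : 0 < D)
    (hD : ∀ x h, |η (x + h) + η (x - h) - 2 * η x| ≤ D * min (‖h‖ ^ 2) 1) {m : ℝ → ℝ} {W θ ε : ℝ}
    (hm : 0 ≤ m p.2) (hε : 0 < ε) (hε1 : ε ≤ 1) (hp : ‖p.1‖ ≤ 3 / 2)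
    (hle : ∀ x, u (x, p.2) ≤ W - m p.2 * η x + θ * Real.exp p.2)
    {S : Set (EuclideanSpace ℝ (Fin n))} (hS : MeasurableSet S) (hS1 : S ⊆ Metric.ball 0 1)
    (hgap : ∀ x ∈ S, u (x, p.2) ≤ W - m p.2 * η x + θ * Real.exp p.2 - 1 / 2) :
    extremalPlus lam Lam σ (replaceOn (backCylinder ε p)
        (fun q => W - m q.2 * η q.1 + θ * Real.exp q.2) u) p ≤
      m p.2 * spaceOp lam Lam σ (fun z => -η z) p.1 -
        lam * (1 / 2) * (5 / 2) ^ (-(n : ℝ) - σ) * volume.real (S \ Metric.ball p.1 ε) := by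
  refine spaceOp_le_of_touching (v := fun x => replaceOn (backCylinder ε p)
    (fun q => W - m q.2 * η q.1 + θ * Real.exp q.2) u (x, p.2)) (g := fun x => u (x, p.2))
    (W := W + θ * Real.exp p.2) hn hlam hLam hσ hu hC hη h01 hD0 hD hm hε hε1 hp
    (fun x => by linarith [hle x]) hS hS1 (fun x hx => by linarith [hgap x hx])
    (fun x hx => ?_) fun x hx => if_neg fun h => hx h.1
  have hmem : (x, p.2) ∈ backCylinder ε p := ⟨hx, by simp only; linarith, le_rfl⟩
  simp only [replaceOn, if_pos hmem]
  ring

theorem mainTheorem3 (n : ℕ) (hn : 1 ≤ n) (lam Lam σ α₀ μ : ℝ)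
    (hlam : 0 < lam) (hLam : lam ≤ Lam) (hσ : σ ∈ Ioo (0 : ℝ) 2)
    (hα₀ : α₀ ∈ Ioo (0 : ℝ) 1) (hμ : 0 < μ) :
    ∃ ε₀ > 0, ∃ θ > 0, ∀ α ∈ Ico α₀ 1, ∀ u : EuclideanSpace ℝ (Fin n) × ℝ → ℝ,
      UpperSemicontinuousOn u (univ ×ˢ Iic 0) →
      (∃ C, ∀ x, ∀ t ≤ 0, |u (x, t)| ≤ C) →
      (∀ p ∈ (univ ×ˢ Icc (-2) 0) ∪ (Metric.ball 0 2 ×ˢ Iic 0), u p ≤ 1) →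
      IsViscositySubsolution α lam Lam σ ε₀ (Metric.ball 0 2 ×ˢ Icc (-2) 0) u →
      ENNReal.ofReal μ ≤ volume ({p | u p ≤ 0} ∩ (Metric.ball 0 1 ×ˢ Icc (-2) (-1))) →
      ∀ x ∈ Metric.ball (0 : EuclideanSpace ℝ (Fin n)) 1, ∀ t ∈ Icc (-1 : ℝ) 0,
        u (x, t) ≤ 1 - θ := by
  obtain ⟨η, hηs, h01, hη1, hη0, ⟨D, hD0, hD⟩, Cη, hCη, hηC⟩ :=
    exists_space_barrier (n := n) hn hlam hLam hσ
  set V₁ : ℝ := volume.real (Metric.ball (0 : EuclideanSpace ℝ (Fin n)) 1) with hV₁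
  have hV₁0 : 0 < V₁ := ENNReal.toReal_pos (Metric.measure_ball_pos volume _ one_pos).ne'
    measure_ball_lt_top.ne
  set c : ℝ := lam * (1 / 2) * (5 / 2) ^ (-(n : ℝ) - σ) with hc
  have hc0 : 0 < c := by positivity
  -- The part Cη absorbs ℳ⁺(-η); the part 4cV₁ forces m ≤ cV₁ / C₁ ≤ 1/4, which keeps the gap at
  -- 1/2.
  set C₁ : ℝ := Cη + 4 * c * V₁ with hC₁
  have hC₁0 : 0 < C₁ := by positivity
  obtain ⟨θ₁, hθ₁, hbar⟩ := exists_time_barrier hα₀.1 hC₁0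
  -- Half of the lower bound of m on [-1, 0]: with m ≥ 2θ and eᵗ ≤ 1 there, u > 1 - θ yields W > 1.
  set θ : ℝ := θ₁ * (c * (μ / 2)) / 2 with hθ
  have hθ0 : 0 < θ := by positivity
  -- Half of the lower bound of B(α)θeᵗ on [-2, 0], using B(α) ≥ 3/4.
  set ε₀ : ℝ := 3 / 4 * (θ * Real.exp (-2)) / 2 with hε₀
  have hε₀0 : 0 < ε₀ := by positivity
  refine ⟨ε₀, hε₀0, θ, hθ0, ?_⟩
  rintro α hαm u hu ⟨C, hC⟩ hu1 hvisc hvol x₁ hx₁ t₁ ht₁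
  by_contra! hlt
  have hα : α ∈ Ioo (0 : ℝ) 1 := ⟨hα₀.1.trans_le hαm.1, hαm.2⟩
  obtain ⟨hUo, hUv⟩ := isOpen_sublevel_and_volume hu
  set U := {p | u p < 1 / 4} ∩ Metric.ball (0 : EuclideanSpace ℝ (Fin n)) 1 ×ˢ Ioo (-2 : ℝ) (-1)
    with hU
  obtain ⟨f, hfs, hf0, hfz, hfU, hfμ⟩ := exists_smooth_minorant hUo inter_subset_right hμ
    (hvol.trans hUv)
  have hSsub : ∀ t : ℝ, {x | (x, t) ∈ U} ⊆ Metric.ball 0 1 := fun t x hx => hx.2.1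
  have hfV : ∀ t, f t ≤ V₁ := fun t =>
    (hfU t).trans (measureReal_mono (hSsub t) measure_ball_lt_top.ne)
  obtain ⟨m, hms, hm0, hmF, hmz, hml, hmeq⟩ := hbar α hαm (fun t => c * f t)
    (contDiff_const.mul hfs) (fun t => mul_nonneg hc0.le (hf0 t))
    (fun t ht => by simp [hfz t ht]) (c * V₁)
    (fun t => mul_le_mul_of_nonneg_left (hfV t) hc0.le)
  have hm4 : ∀ t, m t ≤ 1 / 4 := fun t => by
    refine (hmF t).trans ?_
    rw [div_le_iff₀ hC₁0, hC₁]
    linarith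
  have hmabs : ∀ t, |m t| ≤ 1 / 4 := fun t => by rw [abs_of_nonneg (hm0 t)]; exact hm4 t
  have hml' : ∀ t ∈ Icc (-1 : ℝ) 0, 2 * θ ≤ m t := fun t ht => by
    refine le_trans ?_ (hml t ht)
    rw [integral_const_mul, hθ]
    have : θ₁ * (c * (μ / 2)) ≤ θ₁ * (c * ∫ s, f s) := by gcongr
    linarith
  -- the maximum of `u + m η - θ eᵗ`
  set w : EuclideanSpace ℝ (Fin n) × ℝ → ℝ := fun p =>
    u p + (m p.2 * η p.1 - θ * Real.exp p.2) with hw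
  have hηc : Continuous η := hηs.continuous
  have hmc : Continuous m := hms.continuous
  have hwu : UpperSemicontinuousOn w
      (Metric.closedBall (0 : EuclideanSpace ℝ (Fin n)) (3 / 2) ×ˢ Icc (-2 : ℝ) 0) := by
    refine (hu.mono ?_).add (ContinuousOn.upperSemicontinuousOn
      (Continuous.continuousOn (by fun_prop)))
    exact prod_mono (subset_univ _) fun t ht => ht.2
  have hp₁ : (x₁, t₁) ∈ Metric.closedBall (0 : EuclideanSpace ℝ (Fin n)) (3 / 2) ×ˢ
      Icc (-2 : ℝ) 0 :=
    ⟨Metric.ball_subset_closedBall (Metric.ball_subset_ball (by norm_num) hx₁),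
      by linarith [ht₁.1], ht₁.2⟩
  obtain ⟨⟨x₀, t₀⟩, hp₀, hmax⟩ := hwu.exists_isMaxOn ⟨_, hp₁⟩
    ((isCompact_closedBall _ _).prod isCompact_Icc)
  obtain ⟨hx₀, ht₀⟩ := hp₀
  simp only at hx₀ ht₀
  set W := w (x₀, t₀) with hW
  have hW1 : 1 < W := by
    refine lt_of_lt_of_le ?_ (hmax hp₁)
    have h1 := hml' t₁ ht₁
    have h2 : θ * Real.exp t₁ ≤ θ * 1 := by
      gcongr
      exact Real.exp_le_one_iff.2 ht₁.2
    simp only [hw, hη1 x₁ hx₁]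
    linarith
  set φ : EuclideanSpace ℝ (Fin n) × ℝ → ℝ := fun p =>
    W - m p.2 * η p.1 + θ * Real.exp p.2 with hφ
  have hφs : ContDiff ℝ ((⊤ : ℕ∞) : WithTop ℕ∞) φ :=
    (contDiff_const.sub ((hms.comp contDiff_snd).mul (hηs.comp contDiff_fst))).add
      (contDiff_const.mul (Real.contDiff_exp.comp contDiff_snd))
  have hle1 : ∀ x, ∀ t ∈ Icc (-2 : ℝ) 0, u (x, t) ≤ φ (x, t) := fun x t ht => by
    have he := mul_pos hθ0 (Real.exp_pos t)
    by_cases hx : x ∈ Metric.closedBall (0 : EuclideanSpace ℝ (Fin n)) (3 / 2)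
    · have : w (x, t) ≤ W := hmax (a := (x, t)) ⟨hx, ht⟩
      simp only [hw, hφ] at this ⊢
      linarith
    · have := hu1 (x, t) (Or.inl ⟨mem_univ _, ht⟩)
      simp only [hφ, hη0 x hx]
      linarith
  -- Before time -2 the barrier m vanishes, so φ > W > 1 ≥ u in B₂.
  have hle2 : ∀ x ∈ Metric.ball (0 : EuclideanSpace ℝ (Fin n)) 2, ∀ t ≤ (0 : ℝ),
      u (x, t) ≤ φ (x, t) := fun x hx t ht => by
    by_cases h2 : -2 ≤ t
    · exact hle1 x t ⟨h2, ht⟩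
    · have he := mul_pos hθ0 (Real.exp_pos t)
      have := hu1 (x, t) (Or.inr ⟨hx, ht⟩)
      simp only [hφ, hmz t (le_of_not_ge h2)]
      linarith
  have hφ₀ : φ (x₀, t₀) = u (x₀, t₀) := by
    simp only [hφ, hW, hw]
    ring
  have hx₀n : ‖x₀‖ ≤ 3 / 2 := by simpa using hx₀
  have hx₀2 : x₀ ∈ Metric.ball (0 : EuclideanSpace ℝ (Fin n)) 2 := by
    simp only [Metric.mem_ball, dist_zero_right]
    linarith
  -- The bound 1/2 keeps the cylinder over B₂; the other makes the part of the gap lost inside the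
  -- ball cost at most ε₀/2.
  set ε : ℝ := min (1 / 2) (ε₀ / (2 * (c * V₁))) with hε
  have hε0 : 0 < ε := by positivity
  have hε2 : ε ≤ 1 / 2 := min_le_left _ _
  have hballε : c * volume.real (Metric.ball x₀ ε) ≤ ε₀ / 2 := by
    calc c * volume.real (Metric.ball x₀ ε) ≤ c * (ε * V₁) := by
          gcongr
          exact volume_real_ball_le hn hε0 (by linarith) x₀
      _ = ε * (c * V₁) := by ring
      _ ≤ ε₀ / (2 * (c * V₁)) * (c * V₁) := by gcongr; exact min_le_right _ _
      _ = ε₀ / 2 := by field_simp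
  have hcyl : ∀ q ∈ backCylinder ε (x₀, t₀), u q ≤ φ q := by
    rintro ⟨x, t⟩ ⟨hx, ht⟩
    simp only at hx ht
    refine hle2 x ?_ t (ht.2.trans ht₀.2)
    simp only [Metric.mem_ball] at hx ⊢
    have := dist_triangle x x₀ 0
    rw [dist_zero_right x₀] at this
    linarith
  have hmain := hvisc (x₀, t₀) ⟨hx₀2, ht₀⟩ ε hε0 φ hφs hφ₀ hcyl
  have htime : ε₀ * 2 - η x₀ * timeOp α m t₀ ≤
      timeDeriv α (replaceOn (backCylinder ε (x₀, t₀)) φ u) (x₀, t₀) := by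
    refine le_trans ?_ (le_timeDeriv_replaceOn hα hu hC hmc hmabs (η := η) (W := W) (θ := θ)
      (p := (x₀, t₀)) ht₀.2 hε0 fun s hs => hle2 x₀ hx₀2 s (hs.trans ht₀.2))
    have : ε₀ * 2 = 3 / 4 * (θ * Real.exp (-2)) := by rw [hε₀]; ring
    rw [this]
    have h1 := (abNorm_mem_Icc hα).1
    have h2 := ht₀.1
    gcongr
  have hspace : extremalPlus lam Lam σ (replaceOn (backCylinder ε (x₀, t₀)) φ u) (x₀, t₀) ≤
      m t₀ * (Cη * η x₀) - c * f t₀ + ε₀ / 2 := by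
    have hSm : MeasurableSet {x | (x, t₀) ∈ U} :=
      (hUo.preimage (by fun_prop : Continuous fun x : EuclideanSpace ℝ (Fin n) =>
        (x, t₀))).measurableSet
    have key := extremalPlus_replaceOn_le (p := (x₀, t₀)) (W := W) (θ := θ) hn hlam hLam hσ
      (measurable_slice_space hu ht₀.2) (fun x => hC x t₀ ht₀.2) hηc h01 hD0 hD (hm0 t₀) hε0
      (by linarith) hx₀n (fun x => hle1 x t₀ ht₀) hSm (hSsub t₀) fun x hx => by
        have h1 : u (x, t₀) < 1 / 4 := hx.1
        have h2 := mul_pos hθ0 (Real.exp_pos t₀)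
        have h3 : m t₀ * η x ≤ 1 / 4 := by nlinarith [hm4 t₀, hm0 t₀, (h01 x).1, (h01 x).2]
        simp only
        linarith
    have hdiff : f t₀ - volume.real (Metric.ball x₀ ε) ≤
        volume.real ({x | (x, t₀) ∈ U} \ Metric.ball x₀ ε) := by
      have h1 := le_measureReal_sdiff (μ := volume) (s₁ := {x | (x, t₀) ∈ U})
        (s₂ := Metric.ball x₀ ε) measure_ball_lt_top.ne
      linarith [hfU t₀]
    have h1 := mul_le_mul_of_nonneg_left hdiff hc0.le
    have h2 := mul_le_mul_of_nonneg_left (hηC x₀ hx₀) (hm0 t₀)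
    refine key.trans ?_
    simp only [← hc]
    linarith
  -- Inserting the equation of m leaves a difference of at least 2ε₀ - ε₀/2 > ε₀.
  have h1 := hmeq t₀
  have h2 : timeOp α m t₀ = c * f t₀ - C₁ * m t₀ := by linarith
  rw [h2] at htime
  have h3 : η x₀ * (c * f t₀) ≤ c * f t₀ :=
    mul_le_of_le_one_left (mul_nonneg hc0.le (hf0 t₀)) (h01 x₀).2
  have h4 : Cη * (m t₀ * η x₀) ≤ C₁ * (m t₀ * η x₀) := by
    refine mul_le_mul_of_nonneg_right ?_ (mul_nonneg (hm0 t₀) (h01 x₀).1)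
    rw [hC₁]
    have : 0 < 4 * c * V₁ := by positivity
    linarith
  linarith

end Main
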